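/- Let $G$ be an $\ell_c$-group, that is, a Hausdorff, locally compact, totally disconnected topological group such that every element of $G$ lies in a compact open subgroup and any two compact open subgroups of $G$ are contained in a third. A complex representation of $G$ is called smooth if the stabilizer of every vector is open, and a smooth representation is called admissible if the subspace of vectors fixed by any compact open subgroup is finite-dimensional. Assume that $G$ is tame, that is, every irreducible smooth representation of $G$ is admissible. Let $\widehat{G}$ be the set of isomorphism classes of irreducible smooth representations of $G$, endowed with the Fell topology: for $(\pi,V)\in\widehat{G}$, vectors $v_1,\dots,v_n\in V$, linear functionals $\xi_1,\dots,\xi_n$ in the smooth dual of $V$ (i.e. with open stabilizer in $G$), a compact subset $B\subset G$ and $\varepsilon>0$, the set of those $(\sigma,X)\in\widehat{G}$ for which there exist $w_1,\dots,w_n\in X$ and $\zeta_1,\dots,\zeta_n$ in the smooth dual of $X$ with \[ |\langle \xi_j,\pi(g)v_j\rangle-\langle \zeta_j,\sigma(g)w_j\rangle|<\varepsilon \qquad (1\le j\le n,\ g\in B) \] is a basic neighbourhood of $\pi$, and a subset of $\widehat{G}$ is open if and only if it contains a basic neighbourhood of each of its points. The support of a smooth representation $M$ is $\operatorname{Supp}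 M=\{\pi\in\widehat{G} : \operatorname{Hom}_G(M,\pi)\neq 0\}$, and for $S\subset\widehat{G}$ let $\mathcal{R}(G)_S$ be the full subcategory of the category of smooth representations of $G$ consisting of those with support contained in $S$. Let $W\subset\widehat{G}$ be locally closed and let $Z\subset W$ be any subset. Then the inclusion functor $i_!:\mathcal{R}(G)_Z\to\mathcal{R}(G)_W$ has a left adjoint $i^*:\mathcal{R}(G)_W\to\mathcal{R}(G)_Z$ if and only if $Z$ is closed in $W$. When $i^*$ exists it is exact, i.e. it takes exact sequences to exact sequences. -/

import Mathlib

open CategoryTheory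

universe u

namespace EllGroup

section Basic

variable {G : Type u} [Group G] [TopologicalSpace G]

/-- A subgroup which is both compact and open. -/
def IsCompactOpen (K : Subgroup G) : Prop :=
  IsCompact (K : Set G) ∧ IsOpen (K : Set G)

variable (G) in
/-- An `ℓ`-group: a topological group whose underlying space is Hausdorff, locally compact and
totally disconnected. -/
structure IsEllGroup : Prop where
  isTopologicalGroup : IsTopologicalGroup G
  t2 : T2Space G
  locallyCompact : LocallyCompactSpace G
  totallyDisconnected : TotallyDisconnectedSpace G

variable (G) in
/-- An `ℓ_c`-group: an `ℓ`-group which is the filtered union of its compact open subgroups. -/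
structure IsEllCGroup : Prop extends IsEllGroup G where
  exists_mem : ∀ g : G, ∃ K : Subgroup G, IsCompactOpen K ∧ g ∈ K
  directed : ∀ K L : Subgroup G, IsCompactOpen K → IsCompactOpen L →
    ∃ H : Subgroup G, IsCompactOpen H ∧ K ≤ H ∧ L ≤ H

/-- A complex representation is smooth if every vector has an open stabilizer. -/
def IsSmooth (M : Rep.{u} ℂ G) : Prop :=
  ∀ v : M.V, IsOpen {g : G | M.ρ g v = v}

/-- A smooth representation is admissible if the subspace fixed by any compact open subgroup is
finite-dimensional. -/
def IsAdmissible (M : Rep.{u} ℂ G) : Prop :=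
  IsSmooth M ∧ ∀ K : Subgroup G, IsCompactOpen K →
    FiniteDimensional ℂ (Representation.invariants (M.ρ.comp K.subtype))

variable (G) in
/-- The property of being an irreducible (in particular nonzero) smooth representation. -/
def isIrreducibleSmooth : ObjectProperty (Rep.{u} ℂ G) :=
  fun M => IsSmooth M ∧ M.ρ.IsIrreducible

variable (G) in
/-- The irreducible smooth representations of `G`. -/
abbrev Irr : Type (u + 1) := (isIrreducibleSmooth G).FullSubcategory

variable (G) in
/-- `G` is tame if all its irreducible smooth representations are admissible. -/
def IsTame : Prop := ∀ π : Irr G, IsAdmissible π.obj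

variable (G) in
/-- The smooth dual of `G`: the isomorphism classes of irreducible smooth representations. -/
def SmoothDual : Type (u + 1) := Quotient (isIsomorphicSetoid (Irr G))

/-- The isomorphism class of an irreducible smooth representation. -/
def Irr.cls (π : Irr G) : SmoothDual G := Quotient.mk (isIsomorphicSetoid (Irr G)) π

/-- A linear functional lies in the smooth dual representation if its stabilizer is open. -/
def IsSmoothFunctional (M : Rep.{u} ℂ G) (ξ : Module.Dual ℂ M.V) : Prop :=
  IsOpen {g : G | M.ρ.dual g ξ = ξ}

/-- The basic Fell neighbourhood of `π` attached to vectors `v₁, …, vₙ`, functionals `ξ₁, …, ξₙ`,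
a subset `B` of `G` and `ε`: the classes of those `σ` which admit vectors `wⱼ` and smooth
functionals `ζⱼ` whose matrix coefficients are within `ε` of those of `π` on `B`. -/
def fellNhd (π : Irr G) {n : ℕ} (v : Fin n → π.obj.V) (ξ : Fin n → Module.Dual ℂ π.obj.V)
    (B : Set G) (ε : ℝ) : Set (SmoothDual G) :=
  {x | ∃ σ : Irr G, σ.cls = x ∧
    ∃ (w : Fin n → σ.obj.V) (ζ : Fin n → Module.Dual ℂ σ.obj.V),
      (∀ j, IsSmoothFunctional σ.obj (ζ j)) ∧
      ∀ j, ∀ g ∈ B, ‖ξ j (π.obj.ρ g (v j)) - ζ j (σ.obj.ρ g (w j))‖ < ε}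

/-- `S` contains a basic Fell neighbourhood of `π`, given by finitely many vectors and smooth
functionals, a compact subset of `G`, and a positive real number. -/
def ContainsFellNhd (π : Irr G) (S : Set (SmoothDual G)) : Prop :=
  ∃ (n : ℕ) (v : Fin n → π.obj.V) (ξ : Fin n → Module.Dual ℂ π.obj.V) (B : Set G) (ε : ℝ),
    (∀ j, IsSmoothFunctional π.obj (ξ j)) ∧ IsCompact B ∧ 0 < ε ∧ fellNhd π v ξ B ε ⊆ S

theorem ContainsFellNhd.mono {π : Irr G} {S T : Set (SmoothDual G)} (h : ContainsFellNhd π S)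
    (hST : S ⊆ T) : ContainsFellNhd π T := by
  obtain ⟨n, v, ξ, B, ε, h1, h2, h3, h4⟩ := h
  exact ⟨n, v, ξ, B, ε, h1, h2, h3, h4.trans hST⟩

theorem ContainsFellNhd.inter {π : Irr G} {S T : Set (SmoothDual G)} (hS : ContainsFellNhd π S)
    (hT : ContainsFellNhd π T) : ContainsFellNhd π (S ∩ T) := by
  obtain ⟨n, v, ξ, B, ε, h1, h2, h3, h4⟩ := hS
  obtain ⟨m, v', ξ', B', ε', h1', h2', h3', h4'⟩ := hT
  refine ⟨n + m, Fin.append v v', Fin.append ξ ξ', B ∪ B', min ε ε', ?_, h2.union h2',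
    lt_min h3 h3', ?_⟩
  · intro j
    refine Fin.addCases (fun i => ?_) (fun i => ?_) j
    · rw [Fin.append_left]; exact h1 i
    · rw [Fin.append_right]; exact h1' i
  · rintro x ⟨σ, hσ, w, ζ, hζ, hw⟩
    constructor
    · refine h4 ⟨σ, hσ, fun i => w (Fin.castAdd m i), fun i => ζ (Fin.castAdd m i),
        fun i => hζ _, fun i g hg => ?_⟩
      have := hw (Fin.castAdd m i) g (Or.inl hg)
      rw [Fin.append_left, Fin.append_left] at this
      exact this.trans_le (min_le_left _ _)
    · refine h4' ⟨σ, hσ, fun i => w (Fin.natAdd n i), fun i => ζ (Fin.natAdd n i),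
        fun i => hζ _, fun i g hg => ?_⟩
      have := hw (Fin.natAdd n i) g (Or.inr hg)
      rw [Fin.append_right, Fin.append_right] at this
      exact this.trans_le (min_le_right _ _)

/-- The Fell topology on the smooth dual: a set is open if and only if it contains a basic Fell
neighbourhood of each of its points. -/
instance fellTopology : TopologicalSpace (SmoothDual G) where
  IsOpen S := ∀ π : Irr G, π.cls ∈ S → ContainsFellNhd π S
  isOpen_univ := fun _ _ => ⟨0, Fin.elim0, Fin.elim0, ∅, 1, fun j => j.elim0, isCompact_empty,
    one_pos, Set.subset_univ _⟩
  isOpen_inter := fun _ _ hS hT π hπ => (hS π hπ.1).inter (hT π hπ.2)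
  isOpen_sUnion := fun _ h π ⟨S, hS, hπ⟩ => (h S hS π hπ).mono (Set.subset_sUnion_of_mem hS)

/-- The support of a representation `M`: the classes of the `π` with `Hom_G(M, π) ≠ 0`. -/
def supp (M : Rep.{u} ℂ G) : Set (SmoothDual G) :=
  {x | ∃ π : Irr G, π.cls = x ∧ ∃ f : M ⟶ π.obj, f ≠ 0}

/-- The property of being a smooth representation with support contained in `S`. -/
def smoothSupportedIn (S : Set (SmoothDual G)) : ObjectProperty (Rep.{u} ℂ G) :=
  fun M => IsSmooth M ∧ supp M ⊆ S

/-- The full subcategory `R(G)_S` of smooth representations of `G` with support contained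
in `S`. -/
abbrev SmoothRepOn (S : Set (SmoothDual G)) : Type (u + 1) :=
  (smoothSupportedIn S).FullSubcategory

/-- The inclusion functor `R(G)_Z ⥤ R(G)_W` for `Z ⊆ W`. -/
abbrev inclusion {Z W : Set (SmoothDual G)} (h : Z ⊆ W) : SmoothRepOn Z ⥤ SmoothRepOn W :=
  ObjectProperty.ιOfLE (fun _ hM => ⟨hM.1, hM.2.trans h⟩)

/-- The sequence `M ⟶ N ⟶ P` of representations in `R(G)_S` is exact at `N`: the image of the
first map is the kernel of the second. -/
def IsExactAt {S : Set (SmoothDual G)} {M N P : SmoothRepOn S} (f : M ⟶ N) (g : N ⟶ P) : Prop :=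
  Function.Exact f.hom.hom g.hom.hom

/-- A functor `R(G)_S ⥤ R(G)_T` is exact if it takes exact sequences to exact sequences. -/
def IsExactFunctor {S T : Set (SmoothDual G)} (F : SmoothRepOn S ⥤ SmoothRepOn T) : Prop :=
  ∀ ⦃M N P : SmoothRepOn S⦄ (f : M ⟶ N) (g : N ⟶ P),
    IsExactAt f g → IsExactAt (F.map f) (F.map g)

end Basic

end EllGroup

/-!
The Fell topology is analysed through radicals. For a set `C` of classes of irreducible
representations, `radical C M` is the common kernel of all maps from `M` to members of `C`.

Over a compact open subgroup everything is semisimple, and `G` is the directed union of its compact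
open subgroups. This makes every admissible representation `π` injective among the smooth ones
(`exists_extension`): extending a map to one more vector `b`, fixed by `K`, amounts to solving a
system of linear equations indexed by `ℂ[G]` in the finite-dimensional space of `K`-fixed vectors of
`π`; the equations coming from each compact open subgroup are solvable by Maschke's theorem, hence so
is the whole system (`exists_solution_of_directed`). As `G` is tame, irreducible representations are
injective. Consequently supports do not grow under passage to subrepresentations, and irreducible
quotients separate vectors (`exists_irreducible_quotient`).

Two facts link radicals with the topology.
* If `C` is closed, `M / radical C M` has support in `C` (`cls_mem_of_radical_le_ker`). For large
  compact open `L` the `K`-fixed vectors of an irreducible `π` generate an irreducible representation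
  of `L` (`exists_irreducible_orbitSpan`), and any irreducible representation containing a copy of it
  lies in a prescribed Fell neighbourhood of `π`.
* For `x ∈ ℂ[G ⧸ K]`, the irreducible representations in which `x` does not annihilate the `K`-fixed
  vectors form an open set (`isOpen_cosetLift_ne_zero`).

If `Z = W ∩ C` with `C` closed, the left adjoint is therefore `M ↦ M / radical C M`. Any left adjoint
has surjective unit maps with kernel `radical C M`, and exactness reduces to the
compatibility of radicals with subrepresentations and quotients (`mem_sup_radical`). Conversely, let
`W = U ∩ C` with `U` open and `C` closed. The radical of `ℂ[G ⧸ K]` for the complement of `U`, modulo its radical for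
`C`, is an object of `R(G)_W` that maps onto every member of `W` with a nonzero `K`-fixed vector.
Evaluating a left adjoint on it shows that each point of `W` in the closure of `Z` lies in `Z`
(`cls_mem_of_mem_closure`).
-/

namespace EllGroup

/-! ### Averages over groups modulo a subgroup of finite index -/

section CosetAverage

theorem apply_out_of_rightInvariant {L E : Type*} [Group L] {N : Subgroup L} {F : L → E}
    (hF : ∀ g, ∀ n ∈ N, F (g * n) = F g) (g : L) :
    F (g : L ⧸ N).out = F g := by
  obtain ⟨n, hn⟩ := QuotientGroup.mk_out_eq_mul N g
  rw [hn, hF _ _ n.2]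

variable {L : Type*} [Group L] {E : Type*} [AddCommGroup E] [Module ℂ E]

/-- The average of a function `F` over a group, computed on representatives of the finitely many
left cosets of `N`. It is meaningful for functions that are right-invariant under `N`. -/
noncomputable def cosetAvg (N : Subgroup L) [N.FiniteIndex] (F : L → E) : E :=
  letI := Fintype.ofFinite (L ⧸ N)
  (Fintype.card (L ⧸ N) : ℂ)⁻¹ • ∑ c : L ⧸ N, F c.out

variable {N : Subgroup L} [N.FiniteIndex]

theorem cosetAvg_add (F F' : L → E) :
    cosetAvg N (fun g => F g + F' g) = cosetAvg N F + cosetAvg N F' := by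
  simp [cosetAvg, Finset.sum_add_distrib]

theorem cosetAvg_sub (F F' : L → E) :
    cosetAvg N (fun g => F g - F' g) = cosetAvg N F - cosetAvg N F' := by
  simp [cosetAvg, Finset.sum_sub_distrib, smul_sub]

theorem map_cosetAvg {E' : Type*} [AddCommGroup E'] [Module ℂ E'] (T : E →ₗ[ℂ] E') (F : L → E) :
    T (cosetAvg N F) = cosetAvg N (fun g => T (F g)) := by
  simp [cosetAvg, map_sum]

theorem cosetAvg_const (v : E) : cosetAvg N (fun _ => v) = v := by
  let _ := Fintype.ofFinite (L ⧸ N)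
  simp only [cosetAvg, Finset.sum_const, Finset.card_univ, ← Nat.cast_smul_eq_nsmul ℂ, smul_smul]
  rw [inv_mul_cancel₀, one_smul]
  exact_mod_cast Fintype.card_ne_zero

theorem cosetAvg_mem {A : Submodule ℂ E} {F : L → E} (h : ∀ g, F g ∈ A) : cosetAvg N F ∈ A :=
  A.smul_mem _ (A.sum_mem fun _ _ => h _)

theorem cosetAvg_comm {L' : Type*} [Group L'] {N' : Subgroup L'} [N'.FiniteIndex]
    (F : L → L' → E) :
    cosetAvg N (fun g => cosetAvg N' (F g)) =
      cosetAvg N' (fun h => cosetAvg N (fun g => F g h)) := by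
  simp only [cosetAvg, ← Finset.smul_sum]
  rw [smul_comm, Finset.sum_comm]

theorem norm_cosetAvg_lt {F : L → ℂ} {ε : ℝ} (h : ∀ g, ‖F g‖ < ε) : ‖cosetAvg N F‖ < ε := by
  let _ := Fintype.ofFinite (L ⧸ N)
  have h0 : (0 : ℝ) < Fintype.card (L ⧸ N) := by exact_mod_cast Fintype.card_pos
  have h1 : ‖∑ c : L ⧸ N, F c.out‖ < Fintype.card (L ⧸ N) * ε := by
    refine (norm_sum_le _ _).trans_lt ((Finset.sum_lt_sum_of_nonempty Finset.univ_nonempty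
      fun c _ => h c.out).trans_eq ?_)
    simp
  simp only [cosetAvg, norm_smul, norm_inv, Complex.norm_natCast]
  convert (inv_mul_lt_iff₀ h0).2 h1 using 3

theorem cosetAvg_mul_left {F : L → E} (hF : ∀ g, ∀ n ∈ N, F (g * n) = F g) (h : L) :
    cosetAvg N (fun g => F (h * g)) = cosetAvg N F := by
  let _ := Fintype.ofFinite (L ⧸ N)
  refine congrArg (fun x : E => (_ : ℂ) • x) ?_
  refine Fintype.sum_bijective (fun c : L ⧸ N => h • c) (MulAction.bijective h) _ _ fun c => ?_
  obtain ⟨g, rfl⟩ := QuotientGroup.mk_surjective c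
  refine (apply_out_of_rightInvariant (F := fun g => F (h * g))
    (fun g n hn => by simp [← mul_assoc, hF _ _ hn]) g).trans ?_
  change _ = F ((h * g : L) : L ⧸ N).out
  rw [apply_out_of_rightInvariant hF]

theorem cosetAvg_mul_right [N.Normal] {F : L → E} (hF : ∀ g, ∀ n ∈ N, F (g * n) = F g) (h : L) :
    cosetAvg N (fun g => F (g * h)) = cosetAvg N F := by
  let _ := Fintype.ofFinite (L ⧸ N)
  refine congrArg (fun x : E => (_ : ℂ) • x) ?_
  refine Fintype.sum_bijective (fun c : L ⧸ N => c * (h : L ⧸ N)) (Group.mulRight_bijective _)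
    _ _ fun c => ?_
  obtain ⟨g, rfl⟩ := QuotientGroup.mk_surjective c
  refine (apply_out_of_rightInvariant (F := fun g => F (g * h)) (fun g n hn => ?_) g).trans ?_
  · have h1 : g * n * h = g * h * (h⁻¹ * n * h⁻¹⁻¹) := by group
    rw [h1, hF _ _ (Subgroup.Normal.conj_mem inferInstance n hn h⁻¹)]
  · rw [← QuotientGroup.mk_mul, apply_out_of_rightInvariant hF]

end CosetAverage

section Averaging

variable {L : Type*} [Group L] {V : Type*} [AddCommGroup V] [Module ℂ V]
  (ρ : Representation ℂ L V)

/-- The vectors fixed by a subgroup. -/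
noncomputable abbrev fixedPts (H : Subgroup L) : Submodule ℂ V :=
  Representation.invariants (ρ.comp H.subtype)

variable {ρ}

theorem mem_fixedPts {H : Subgroup L} {v : V} : v ∈ fixedPts ρ H ↔ ∀ h ∈ H, ρ h v = v := by
  simp [Representation.mem_invariants]

theorem fixedPts_anti {H H' : Subgroup L} (h : H ≤ H') : fixedPts ρ H' ≤ fixedPts ρ H :=
  fun _ hv => mem_fixedPts.2 fun g hg => mem_fixedPts.1 hv g (h hg)

theorem apply_mem_fixedPts {N : Subgroup L} [N.Normal] {v : V} (hv : v ∈ fixedPts ρ N) (g : L) :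
    ρ g v ∈ fixedPts ρ N := by
  rw [mem_fixedPts] at hv ⊢
  intro n hn
  have h1 : n * g = g * (g⁻¹ * n * g⁻¹⁻¹) := by group
  rw [← Module.End.mul_apply, ← map_mul, h1, map_mul, Module.End.mul_apply,
    hv _ (Subgroup.Normal.conj_mem inferInstance n hn g⁻¹)]

theorem orbit_right_inv {N : Subgroup L} {v : V} (hv : v ∈ fixedPts ρ N) :
    ∀ g, ∀ n ∈ N, ρ (g * n) v = ρ g v := by
  intro g n hn
  rw [map_mul, Module.End.mul_apply, mem_fixedPts.1 hv n hn]

/-- Maschke's theorem: a stable subspace `A` of the vectors fixed by a normal subgroup `N` of finite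
index has a linear projection that is equivariant on the vectors fixed by `N`. -/
theorem exists_equivariant_projection (N : Subgroup L) [N.Normal] [N.FiniteIndex]
    {A : Submodule ℂ V} (hA : ∀ g, ∀ a ∈ A, ρ g a ∈ A) (hAN : A ≤ fixedPts ρ N) :
    ∃ p : V →ₗ[ℂ] V, (∀ v, p v ∈ A) ∧ (∀ a ∈ A, p a = a) ∧
      ∀ g, ∀ v ∈ fixedPts ρ N, p (ρ g v) = ρ g (p v) := by
  obtain ⟨p₀, hp₀⟩ := A.subtype.exists_leftInverse_of_injective A.ker_subtype
  replace hp₀ : ∀ a : A, p₀ a = a := fun a => by simpa using LinearMap.congr_fun hp₀ a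
  set F : L → V →ₗ[ℂ] V := fun g => ρ g ∘ₗ A.subtype ∘ₗ p₀ ∘ₗ ρ g⁻¹ with hF
  have hFA : ∀ g v, F g v ∈ A := fun g v => hA g _ (p₀ _).2
  have hev : ∀ v, cosetAvg N F v = cosetAvg N fun g => F g v := fun v =>
    map_cosetAvg (LinearMap.applyₗ v) F
  refine ⟨cosetAvg N F, fun v => ?_, fun a ha => ?_, fun g v hv => ?_⟩
  · rw [hev]
    exact cosetAvg_mem fun g => hFA g v
  · rw [hev]
    have h1 : (fun g => F g a) = fun _ => a := by
      funext g
      have := hp₀ ⟨ρ g⁻¹ a, hA _ _ ha⟩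
      simp [hF, this]
    rw [h1, cosetAvg_const]
  · rw [hev, hev, map_cosetAvg, ← cosetAvg_mul_left _ g]
    · congr 1
      funext x
      simp [hF]
    · intro x n hn
      have h1 : ρ n⁻¹ (ρ x⁻¹ (ρ g v)) = ρ x⁻¹ (ρ g v) :=
        mem_fixedPts.1 (apply_mem_fixedPts (apply_mem_fixedPts hv g) x⁻¹) _ (N.inv_mem hn)
      have h2 := mem_fixedPts.1 (hAN (p₀ (ρ x⁻¹ (ρ g v))).2) n hn
      simp [hF, h1, h2]

/-- Two coset averages of the same orbit map agree: each average is fixed by the whole group, and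
the two averaging operators commute. -/
theorem cosetAvg_orbit_eq (N N' : Subgroup L) [N.Normal] [N'.Normal] [N.FiniteIndex]
    [N'.FiniteIndex] {v : V} (hv : v ∈ fixedPts ρ N) (hv' : v ∈ fixedPts ρ N') :
    cosetAvg N (fun g => ρ g v) = cosetAvg N' (fun g => ρ g v) := by
  have key : ∀ (N N' : Subgroup L) [N.Normal] [N'.Normal] [N.FiniteIndex] [N'.FiniteIndex],
      v ∈ fixedPts ρ N → v ∈ fixedPts ρ N' →
      cosetAvg N' (fun h => cosetAvg N (fun g => ρ g (ρ h v))) = cosetAvg N (fun g => ρ g v) := by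
    intro N N' _ _ _ _ hv hv'
    have h1 : ∀ h, cosetAvg N (fun g => ρ g (ρ h v)) = cosetAvg N (fun g => ρ g v) := fun h => by
      rw [← cosetAvg_mul_right (F := fun g => ρ g v) (orbit_right_inv hv) h]
      simp
    simp only [h1, cosetAvg_const]
  have key' : ∀ (N N' : Subgroup L) [N.Normal] [N'.Normal] [N.FiniteIndex] [N'.FiniteIndex],
      v ∈ fixedPts ρ N → v ∈ fixedPts ρ N' →
      cosetAvg N (fun g => cosetAvg N' (fun h => ρ g (ρ h v))) = cosetAvg N' (fun h => ρ h v) := by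
    intro N N' _ _ _ _ hv hv'
    have h1 : ∀ g, cosetAvg N' (fun h => ρ g (ρ h v)) = cosetAvg N' (fun h => ρ h v) := fun g => by
      rw [← cosetAvg_mul_left (F := fun g => ρ g v) (orbit_right_inv hv') g]
      simp
    simp only [h1, cosetAvg_const]
  rw [← key N N' hv hv', ← key' N N' hv hv', cosetAvg_comm]

variable (ρ) in
/-- A representation is locally finite if each vector is fixed by a normal subgroup of finite
index. Smooth representations of compact groups have this property. -/
def IsLocallyFinite : Prop :=
  ∀ v : V, ∃ N : Subgroup L, N.Normal ∧ N.FiniteIndex ∧ v ∈ fixedPts ρ N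

namespace IsLocallyFinite

theorem exists_fixing_finset (hρ : IsLocallyFinite ρ) (s : Finset V) :
    ∃ N : Subgroup L, N.Normal ∧ N.FiniteIndex ∧ ∀ v ∈ s, v ∈ fixedPts ρ N := by
  classical
  induction s using Finset.induction_on with
  | empty => exact ⟨⊤, inferInstance, inferInstance, by simp⟩
  | insert a s _ ih =>
    obtain ⟨N, hN, hN', h⟩ := ih
    obtain ⟨N₁, hN₁, hN₁', h₁⟩ := hρ a
    refine ⟨N ⊓ N₁, inferInstance, inferInstance, fun v hv => ?_⟩
    rcases Finset.mem_insert.1 hv with rfl | hv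
    · exact fixedPts_anti inf_le_right h₁
    · exact fixedPts_anti inf_le_left (h v hv)

theorem exists_fixing_submodule (hρ : IsLocallyFinite ρ) (X : Submodule ℂ V)
    [FiniteDimensional ℂ X] :
    ∃ N : Subgroup L, N.Normal ∧ N.FiniteIndex ∧ X ≤ fixedPts ρ N := by
  obtain ⟨s, hs⟩ := (Submodule.fg_iff_finiteDimensional X).2 inferInstance
  obtain ⟨N, hN, hN', h⟩ := hρ.exists_fixing_finset s
  exact ⟨N, hN, hN', hs ▸ Submodule.span_le.2 h⟩

/-- A locally finite complex representation has a canonical linear projection onto the invariants,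
given on each vector by the average over its finite orbit. -/
theorem exists_average (hρ : IsLocallyFinite ρ) : ∃ e : V →ₗ[ℂ] V,
    ∀ (N : Subgroup L) [N.Normal] [N.FiniteIndex], ∀ v ∈ fixedPts ρ N,
      e v = cosetAvg N fun g => ρ g v := by
  choose N hN hN' h using hρ
  have key : ∀ (v : V) (N' : Subgroup L) [N'.Normal] [N'.FiniteIndex], v ∈ fixedPts ρ N' →
      cosetAvg (N v) (fun g => ρ g v) = cosetAvg N' fun g => ρ g v := fun v N' _ _ hv =>
    cosetAvg_orbit_eq _ _ (h v) hv
  refine ⟨{ toFun := fun v => cosetAvg (N v) fun g => ρ g v, map_add' := ?_, map_smul' := ?_ },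
    fun N' _ _ v hv => key v N' hv⟩
  · intro v w
    have hv := fixedPts_anti (H := N v ⊓ N w) inf_le_left (h v)
    have hw := fixedPts_anti (H := N v ⊓ N w) inf_le_right (h w)
    rw [key v _ hv, key w _ hw, key (v + w) _ (add_mem hv hw), ← cosetAvg_add]
    simp
  · intro c v
    rw [key (c • v) (N v) (Submodule.smul_mem _ _ (h v))]
    simp only [map_smul, RingHom.id_apply]
    exact (map_cosetAvg (N := N v) (c • LinearMap.id) fun g => ρ g v).symm

/-- The averaging projection onto the invariants of a locally finite representation. -/
noncomputable def average (hρ : IsLocallyFinite ρ) : V →ₗ[ℂ] V := hρ.exists_average.choose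

theorem average_eq (hρ : IsLocallyFinite ρ) (N : Subgroup L) [N.Normal] [N.FiniteIndex]
    {v : V} (hv : v ∈ fixedPts ρ N) :
    hρ.average v = cosetAvg N fun g => ρ g v :=
  hρ.exists_average.choose_spec N v hv

theorem apply_average (hρ : IsLocallyFinite ρ) (g : L) (v : V) :
    ρ g (hρ.average v) = hρ.average v := by
  obtain ⟨N, _, _, hv⟩ := hρ v
  rw [hρ.average_eq N hv, map_cosetAvg,
    ← cosetAvg_mul_left (F := fun g => ρ g v) (orbit_right_inv hv) g]
  simp

theorem average_apply (hρ : IsLocallyFinite ρ) (g : L) (v : V) :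
    hρ.average (ρ g v) = hρ.average v := by
  obtain ⟨N, _, _, hv⟩ := hρ v
  rw [hρ.average_eq N hv, hρ.average_eq N (apply_mem_fixedPts hv g),
    ← cosetAvg_mul_right (F := fun g => ρ g v) (orbit_right_inv hv) g]
  simp

theorem average_of_fixed (hρ : IsLocallyFinite ρ) {v : V} (hv : ∀ g, ρ g v = v) :
    hρ.average v = v := by
  rw [hρ.average_eq ⊤ (mem_fixedPts.2 fun g _ => hv g)]
  simp only [hv, cosetAvg_const]

theorem average_mem (hρ : IsLocallyFinite ρ) {A : Submodule ℂ V}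
    (hA : ∀ g, ∀ a ∈ A, ρ g a ∈ A) {v : V} (hv : v ∈ A) :
    hρ.average v ∈ A := by
  obtain ⟨N, _, _, h⟩ := hρ v
  rw [hρ.average_eq N h]
  exact cosetAvg_mem fun g => hA g v hv

end IsLocallyFinite

end Averaging

/-! ### The group algebra, and smooth representations of `ℓ_c`-groups -/

section GroupAlgebra

variable {G : Type*} [Group G] {V : Type*} [AddCommGroup V] [Module ℂ V]

/-- The action of a finitely supported function on `G`, as an element of the group algebra. -/
noncomputable def act (ρ : Representation ℂ G V) : (G →₀ ℂ) →ₗ[ℂ] Module.End ℂ V :=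
  Finsupp.linearCombination ℂ fun g => ρ g

variable {ρ : Representation ℂ G V}

theorem act_apply (r : G →₀ ℂ) (v : V) : act ρ r v = r.sum fun g c => c • ρ g v := by
  simp [act, Finsupp.linearCombination_apply, Finsupp.sum, LinearMap.sum_apply]

theorem act_mem {S : Set G} {A : Submodule ℂ V} {v : V} (h : ∀ g ∈ S, ρ g v ∈ A) {r : G →₀ ℂ}
    (hr : r ∈ Finsupp.supported ℂ ℂ S) : act ρ r v ∈ A := by
  rw [act_apply]
  exact A.sum_mem fun g hg => A.smul_mem _ (h g (hr hg))

theorem map_act {W : Type*} [AddCommGroup W] [Module ℂ W] {σ : Representation ℂ G W} {S : Set G}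
    {f : V →ₗ[ℂ] W} {v : V} {w : W} (h : ∀ g ∈ S, f (ρ g v) = σ g w) {r : G →₀ ℂ}
    (hr : r ∈ Finsupp.supported ℂ ℂ S) : f (act ρ r v) = act σ r w := by
  simp only [act_apply, Finsupp.sum, map_sum, map_smul]
  exact Finset.sum_congr rfl fun g hg => by rw [h g (hr hg)]

theorem exists_act_of_mem_span {S : Set G} {v x : V}
    (hx : x ∈ Submodule.span ℂ ((fun g => ρ g v) '' S)) :
    ∃ r ∈ Finsupp.supported ℂ ℂ S, act ρ r v = x := by
  obtain ⟨r, hr, h⟩ := (Finsupp.mem_span_image_iff_linearCombination ℂ).1 hx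
  refine ⟨r, hr, ?_⟩
  rw [← h, act_apply, Finsupp.linearCombination_apply]

variable (ρ) in
/-- The subspace spanned by the translates of the elements of a set `X` by the elements of a
subgroup `L`. -/
def orbitSpan (L : Subgroup G) (X : Set V) : Submodule ℂ V :=
  Submodule.span ℂ {y | ∃ g ∈ L, ∃ x ∈ X, ρ g x = y}

theorem subset_orbitSpan (L : Subgroup G) (X : Set V) : X ⊆ orbitSpan ρ L X :=
  fun x hx => Submodule.subset_span ⟨1, L.one_mem, x, hx, by simp⟩

theorem apply_mem_orbitSpan {L : Subgroup G} {X : Set V} {g : G} (hg : g ∈ L) {x : V}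
    (hx : x ∈ orbitSpan ρ L X) : ρ g x ∈ orbitSpan ρ L X := by
  have : orbitSpan ρ L X ≤ (orbitSpan ρ L X).comap (ρ g) := by
    refine Submodule.span_le.2 ?_
    rintro _ ⟨h, hh, x, hx, rfl⟩
    exact Submodule.subset_span ⟨g * h, L.mul_mem hg hh, x, hx, by simp⟩
  exact this hx

theorem orbitSpan_le {L : Subgroup G} {X : Set V} {A : Submodule ℂ V}
    (hA : ∀ g ∈ L, ∀ a ∈ A, ρ g a ∈ A) (hX : X ⊆ A) : orbitSpan ρ L X ≤ A := by
  refine Submodule.span_le.2 ?_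
  rintro _ ⟨g, hg, x, hx, rfl⟩
  exact hA g hg x (hX hx)

theorem exists_act_of_mem_orbitSpan {L : Subgroup G} {v x : V} (hx : x ∈ orbitSpan ρ L {v}) :
    ∃ r ∈ Finsupp.supported ℂ ℂ (L : Set G), act ρ r v = x := by
  apply exists_act_of_mem_span
  have : {y | ∃ g ∈ L, ∃ x ∈ ({v} : Set V), ρ g x = y} = (fun g => ρ g v) '' L := by
    ext y
    simp
  rwa [orbitSpan, this] at hx

theorem orbitSpan_eq_top_of_isIrreducible (hirr : ρ.IsIrreducible) {x : V} (hx : x ≠ 0) :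
    orbitSpan ρ ⊤ {x} = ⊤ := by
  have := hirr
  let S : Subrepresentation ρ :=
    ⟨orbitSpan ρ ⊤ {x}, fun g _ hv => apply_mem_orbitSpan (Subgroup.mem_top g) hv⟩
  have hxS : x ∈ orbitSpan ρ ⊤ {x} := subset_orbitSpan _ _ rfl
  rcases eq_bot_or_eq_top S with h | h
  · have : x ∈ (⊥ : Subrepresentation ρ) := h ▸ (show x ∈ S from hxS)
    exact absurd this hx
  · exact congrArg Subrepresentation.toSubmodule h

end GroupAlgebra

section Smooth

variable {G : Type*} [Group G] [TopologicalSpace G] {V : Type*} [AddCommGroup V] [Module ℂ V]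

theorem IsCompactOpen.inf [IsTopologicalGroup G] {K U : Subgroup G} (hK : IsCompactOpen K)
    (hU : IsOpen (U : Set G)) : IsCompactOpen (K ⊓ U) :=
  ⟨hK.1.inter_right (U.isClosed_of_isOpen hU), hK.2.inter hU⟩

theorem IsEllCGroup.exists_superset (hG : IsEllCGroup G) {B : Set G} (hB : IsCompact B) :
    ∃ L : Subgroup G, IsCompactOpen L ∧ B ⊆ L := by
  refine hB.induction_on (p := fun s => ∃ L : Subgroup G, IsCompactOpen L ∧ s ⊆ L) ?_ ?_ ?_ ?_
  · obtain ⟨K, hK, -⟩ := hG.exists_mem 1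
    exact ⟨K, hK, Set.empty_subset _⟩
  · rintro s t hst ⟨L, hL, h⟩
    exact ⟨L, hL, hst.trans h⟩
  · rintro s t ⟨L, hL, h⟩ ⟨L', hL', h'⟩
    obtain ⟨H, hH, h₁, h₂⟩ := hG.directed L L' hL hL'
    exact ⟨H, hH, Set.union_subset (h.trans h₁) (h'.trans h₂)⟩
  · intro g _
    obtain ⟨K, hK, hg⟩ := hG.exists_mem g
    exact ⟨K, mem_nhdsWithin_of_mem_nhds (hK.2.mem_nhds hg), K, hK, subset_rfl⟩

theorem IsEllCGroup.exists_ge_superset (hG : IsEllCGroup G) {K : Subgroup G}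
    (hK : IsCompactOpen K) {B : Set G} (hB : IsCompact B) :
    ∃ L : Subgroup G, IsCompactOpen L ∧ K ≤ L ∧ B ⊆ L := by
  obtain ⟨L, hL, h⟩ := hG.exists_superset (hK.1.union hB)
  exact ⟨L, hL, Set.subset_union_left.trans h, Set.subset_union_right.trans h⟩

/-- A representation is smooth if every vector has an open stabilizer. -/
def IsSmoothRep (ρ : Representation ℂ G V) : Prop :=
  ∀ v : V, IsOpen {g : G | ρ g v = v}

/-- The stabilizer of a vector. -/
def stab (ρ : Representation ℂ G V) (v : V) : Subgroup G where
  carrier := {g | ρ g v = v}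
  one_mem' := by simp
  mul_mem' {a b} ha hb := by
    simp only [Set.mem_ofPred_eq] at ha hb ⊢
    rw [map_mul, Module.End.mul_apply, hb, ha]
  inv_mem' {a} ha := by
    simp only [Set.mem_ofPred_eq] at ha ⊢
    nth_rewrite 1 [← ha]
    simp

variable {ρ : Representation ℂ G V}

theorem isOpen_stab_of_mem_fixedPts [IsTopologicalGroup G] {K : Subgroup G}
    (hK : IsOpen (K : Set G)) {v : V} (hv : v ∈ fixedPts ρ K) : IsOpen {g : G | ρ g v = v} :=
  Subgroup.isOpen_mono (H₁ := K) (H₂ := stab ρ v) (fun g hg => mem_fixedPts.1 hv g hg) hK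

theorem IsSmoothRep.exists_fixing (hG : IsEllCGroup G) (hρ : IsSmoothRep ρ) (s : Finset V) :
    ∃ K : Subgroup G, IsCompactOpen K ∧ ∀ v ∈ s, v ∈ fixedPts ρ K := by
  classical
  have := hG.isTopologicalGroup
  induction s using Finset.induction_on with
  | empty =>
    obtain ⟨K, hK, -⟩ := hG.exists_mem 1
    exact ⟨K, hK, by simp⟩
  | insert a s _ ih =>
    obtain ⟨K, hK, h⟩ := ih
    refine ⟨K ⊓ stab ρ a, hK.inf (hρ a), fun v hv => ?_⟩
    rcases Finset.mem_insert.1 hv with rfl | hv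
    · exact mem_fixedPts.2 fun g hg => hg.2
    · exact fixedPts_anti inf_le_left (h v hv)

/-- In a smooth representation, each vector is fixed by an open normal subgroup of any given compact
open subgroup, namely the normal core of a stabilizer. -/
theorem IsSmoothRep.exists_normal_fixing [IsTopologicalGroup G] (hρ : IsSmoothRep ρ)
    {L : Subgroup G} (hL : IsCompactOpen L) (v : V) :
    ∃ N : Subgroup L, N.Normal ∧ N.FiniteIndex ∧ IsCompactOpen (N.map L.subtype) ∧
      v ∈ fixedPts (ρ.comp L.subtype) N := by
  have : CompactSpace L := isCompact_iff_compactSpace.1 hL.1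
  set U := (stab ρ v).subgroupOf L with hU
  have hUo : IsOpen (U : Set L) := (hρ v).preimage continuous_subtype_val
  have := U.quotient_finite_of_isOpen hUo
  have := U.finiteIndex_of_finite_quotient
  have hc : IsClosed (U.normalCore : Set L) := U.normalCore_isClosed (U.isClosed_of_isOpen hUo)
  have ho : IsOpen (U.normalCore : Set L) := U.normalCore.isOpen_of_isClosed_of_finiteIndex hc
  refine ⟨U.normalCore, inferInstance, inferInstance, ⟨?_, ?_⟩,
    mem_fixedPts.2 fun n hn => U.normalCore_le hn⟩
  · exact hc.isCompact.image continuous_subtype_val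
  · exact hL.2.isOpenMap_subtype_val _ ho

theorem IsSmoothRep.isLocallyFinite [IsTopologicalGroup G] (hρ : IsSmoothRep ρ) {L : Subgroup G}
    (hL : IsCompactOpen L) : IsLocallyFinite (ρ.comp L.subtype) := fun v => by
  obtain ⟨N, hN, hN', -, h⟩ := hρ.exists_normal_fixing hL v
  exact ⟨N, hN, hN', h⟩

end Smooth

section Solve

/-- A system of linear equations in a finite-dimensional space, filtered by solvable subsystems, is
solvable. -/
theorem exists_solution_of_directed {X Y ι : Type*} [AddCommGroup X] [Module ℂ X]
    [FiniteDimensional ℂ X] [AddCommGroup Y] [Module ℂ Y] [Nonempty ι]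
    (J : ι → Set ((X →ₗ[ℂ] Y) × Y)) (hdir : Directed (· ⊆ ·) J)
    (h : ∀ i, ∃ w, ∀ e ∈ J i, e.1 w = e.2) : ∃ w, ∀ i, ∀ e ∈ J i, e.1 w = e.2 := by
  -- choose `i₀` with the smallest space of solutions of the homogeneous subsystem
  let D : ι → Submodule ℂ X := fun i => ⨅ e ∈ J i, LinearMap.ker e.1
  have hD : ∀ i x, x ∈ D i ↔ ∀ e ∈ J i, e.1 x = 0 := fun i x => by
    simp only [D, Submodule.mem_iInf, LinearMap.mem_ker]
  obtain ⟨i₀, hi₀⟩ : ∃ i₀, ∀ i, ¬ D i < D i₀ := by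
    obtain ⟨_, ⟨i₀, rfl⟩, h₀⟩ :=
      (wellFounded_lt (α := Submodule ℂ X)).has_min (Set.range D) (Set.range_nonempty D)
    exact ⟨i₀, fun i => h₀ _ ⟨i, rfl⟩⟩
  obtain ⟨w, hw⟩ := h i₀
  refine ⟨w, fun i e he => ?_⟩
  obtain ⟨k, hk₀, hk⟩ := hdir i₀ i
  obtain ⟨w', hw'⟩ := h k
  have h1 : D k ≤ D i₀ := fun x hx => (hD _ _).2 fun e he => (hD _ _).1 hx e (hk₀ he)
  have h2 : D k = D i₀ := h1.eq_of_not_lt (hi₀ k)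
  have h3 : w - w' ∈ D k := by
    rw [h2, hD]
    intro e he
    rw [map_sub, hw e he, hw' e (hk₀ he), sub_self]
  have h4 := (hD _ _).1 h3 e (hk he)
  rw [map_sub, sub_eq_zero] at h4
  rw [h4, hw' e (hk he)]

end Solve

/-! ### Splitting of admissible subrepresentations -/

section Complement

variable {G : Type*} [Group G] [TopologicalSpace G] {Q : Type*} [AddCommGroup Q] [Module ℂ Q]
  {ρ : Representation ℂ G Q}

/-- Solvability over a single compact open subgroup `L ≥ K`. The vectors fixed by a small normal
subgroup of `L` project equivariantly onto those of them that lie in `Γ ⊕ P`, and the `P`-component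
of the image of a `K`-fixed vector `b` satisfies over `ℂ[L]` the relations satisfied by `b` modulo
`Γ`. -/
theorem exists_component [IsTopologicalGroup G] (hρ : IsSmoothRep ρ) {Γ P : Submodule ℂ Q}
    (hΓ : ∀ g, ∀ x ∈ Γ, ρ g x ∈ Γ) (hP : ∀ g, ∀ x ∈ P, ρ g x ∈ P) (hd : Disjoint Γ P)
    {K L : Subgroup G} (hL : IsCompactOpen L) (hKL : K ≤ L) {b : Q} (hb : b ∈ fixedPts ρ K) :
    ∃ w ∈ P ⊓ fixedPts ρ K, ∀ r ∈ Finsupp.supported ℂ ℂ (L : Set G), ∀ γ ∈ Γ, ∀ p ∈ P,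
      act ρ r b = γ + p → act ρ r w = p := by
  have huniq : ∀ γ ∈ Γ, ∀ γ' ∈ Γ, ∀ p ∈ P, ∀ p' ∈ P, γ + p = γ' + p' → p = p' := by
    intro γ hγ γ' hγ' p hp p' hp' h
    have h1 : p - p' = γ' - γ := by
      rw [sub_eq_sub_iff_add_eq_add, add_comm, h]
    exact sub_eq_zero.1 (Submodule.disjoint_def.1 hd _ (h1 ▸ sub_mem hγ' hγ) (sub_mem hp hp'))
  obtain ⟨N, _, _, hbN⟩ := hρ.isLocallyFinite hL b
  set τ : Representation ℂ L Q := ρ.comp L.subtype with hτ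
  have hτa : ∀ (g : L) x, τ g x = ρ g x := fun _ _ => rfl
  obtain ⟨π, hπ, hπ', hπe⟩ := exists_equivariant_projection (ρ := τ) N
    (A := (Γ ⊔ P) ⊓ fixedPts τ N) (by
      rintro g a ⟨ha, haN⟩
      refine ⟨?_, apply_mem_fixedPts haN g⟩
      obtain ⟨γ, hγ, p, hp, rfl⟩ := Submodule.mem_sup.1 ha
      rw [hτa, map_add]
      exact Submodule.add_mem_sup (hΓ _ _ hγ) (hP _ _ hp)) inf_le_right
  obtain ⟨γ₀, hγ₀, w, hw, hsum⟩ := Submodule.mem_sup.1 (hπ b).1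
  have hbL : ∀ g ∈ L, ρ g (π b) = π (ρ g b) := fun g hg => (hπe ⟨g, hg⟩ b hbN).symm
  refine ⟨w, ⟨hw, mem_fixedPts.2 fun k hk => ?_⟩, fun r hr γ hγ p hp h => ?_⟩
  · refine huniq _ (hΓ k _ hγ₀) _ hγ₀ _ (hP k _ hw) _ hw ?_
    rw [← map_add, hsum, hbL k (hKL hk), mem_fixedPts.1 hb k hk]
  · have h1 : π (act ρ r b) = act ρ r (π b) :=
      map_act (S := (L : Set G)) (fun g hg => (hbL g hg).symm) hr
    have h2 : act ρ r b ∈ fixedPts τ N :=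
      act_mem (S := (L : Set G)) (fun g hg => apply_mem_fixedPts (ρ := τ) hbN ⟨g, hg⟩) hr
    rw [hπ' _ ⟨h ▸ Submodule.add_mem_sup hγ hp, h2⟩, h, ← hsum, map_add] at h1
    exact (huniq _ hγ _ (act_mem (S := (L : Set G)) (fun g _ => hΓ g _ hγ₀) hr) _ hp _
      (act_mem (S := (L : Set G)) (fun g _ => hP g _ hw) hr) h1).symm

/-- If `Γ` is disjoint from the admissible subspace `P`, every vector `b` has a translate by an element
of `P` that may be adjoined to `Γ` without meeting `P`. The `K`-fixed vectors of `P` are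
finite-dimensional, so one translate works for all compact open subgroups at once. -/
theorem exists_translate (hG : IsEllCGroup G) (hρ : IsSmoothRep ρ) {Γ P : Submodule ℂ Q}
    (hΓ : ∀ g, ∀ x ∈ Γ, ρ g x ∈ Γ) (hP : ∀ g, ∀ x ∈ P, ρ g x ∈ P) (hd : Disjoint Γ P)
    (hadm : ∀ K : Subgroup G, IsCompactOpen K →
      FiniteDimensional ℂ (P ⊓ fixedPts ρ K : Submodule ℂ Q))
    (b : Q) : ∃ w ∈ P, Disjoint (Γ ⊔ orbitSpan ρ ⊤ {b - w}) P := by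
  have := hG.isTopologicalGroup
  obtain ⟨K, hK, hb⟩ := hρ.exists_fixing hG {b}
  replace hb := hb b (by simp)
  have := hadm K hK
  let X : Submodule ℂ Q := P ⊓ fixedPts ρ K
  let ι := {L : Subgroup G // IsCompactOpen L ∧ K ≤ L}
  let J : ι → Set ((X →ₗ[ℂ] Q) × Q) := fun L => {e | ∃ r ∈ Finsupp.supported ℂ ℂ (L.1 : Set G),
    ∃ γ ∈ Γ, e.2 ∈ P ∧ act ρ r b = γ + e.2 ∧ e.1 = act ρ r ∘ₗ X.subtype}
  have : Nonempty ι := ⟨⟨K, hK, le_rfl⟩⟩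
  have hmono : ∀ L L' : ι, L.1 ≤ L'.1 → J L ⊆ J L' := by
    rintro L L' hLL' e ⟨r, hr, h⟩
    exact ⟨r, Finsupp.supported_mono hLL' hr, h⟩
  obtain ⟨w, hw⟩ := exists_solution_of_directed J (fun L L' => by
    obtain ⟨H, hH, h, h'⟩ := hG.directed L.1 L'.1 L.2.1 L'.2.1
    exact ⟨⟨H, hH, L.2.2.trans h⟩, hmono _ _ h, hmono _ _ h'⟩) (fun L => by
    obtain ⟨w, hw, h⟩ := exists_component hρ hΓ hP hd L.2.1 L.2.2 hb
    refine ⟨⟨w, hw⟩, ?_⟩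
    rintro ⟨_, p⟩ ⟨r, hr, γ, hγ, hp, hrb, rfl⟩
    exact h r hr γ hγ p hp hrb)
  refine ⟨w, w.2.1, Submodule.disjoint_def.2 fun x hx hxP => ?_⟩
  obtain ⟨γ, hγ, y, hy, rfl⟩ := Submodule.mem_sup.1 hx
  obtain ⟨r, -, rfl⟩ := exists_act_of_mem_orbitSpan hy
  obtain ⟨L, hL, hKL, hrL⟩ := hG.exists_ge_superset hK (r.support.finite_toSet.isCompact)
  have h1 : act ρ r w ∈ P := act_mem (S := Set.univ) (fun g _ => hP g _ w.2.1) (by simp)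
  have h2 : act ρ r b = -γ + (γ + act ρ r (b - w) + act ρ r w) := by
    rw [map_sub]; abel
  have h3 := hw ⟨L, hL, hKL⟩ ⟨_, _⟩ ⟨r, hrL, -γ, neg_mem hγ, add_mem hxP h1, h2, rfl⟩
  simp only [Submodule.subtype_apply] at h3
  simpa using h3

/-- An admissible subrepresentation `P` of a smooth representation has a stable complement
containing any given stable subspace that is disjoint from `P`. -/
theorem exists_stable_isCompl (hG : IsEllCGroup G) (hρ : IsSmoothRep ρ) {Γ₀ P : Submodule ℂ Q}
    (hΓ₀ : ∀ g, ∀ x ∈ Γ₀, ρ g x ∈ Γ₀) (hP : ∀ g, ∀ x ∈ P, ρ g x ∈ P) (hd₀ : Disjoint Γ₀ P)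
    (hadm : ∀ K : Subgroup G, IsCompactOpen K →
      FiniteDimensional ℂ (P ⊓ fixedPts ρ K : Submodule ℂ Q)) :
    ∃ Γ : Submodule ℂ Q, (∀ g, ∀ x ∈ Γ, ρ g x ∈ Γ) ∧ Γ₀ ≤ Γ ∧ IsCompl Γ P := by
  obtain ⟨Γ, hle, hmax⟩ := zorn_le_nonempty₀
    {Γ : Submodule ℂ Q | (∀ g, ∀ x ∈ Γ, ρ g x ∈ Γ) ∧ Disjoint Γ P} (by
      intro c hc hchain Γ₁ hΓ₁
      have hdir := hchain.directedOn
      refine ⟨sSup c, ⟨fun g x hx => ?_, Submodule.disjoint_def.2 fun x hx hxP => ?_⟩,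
        fun z hz => le_sSup hz⟩
      · obtain ⟨Γ', hΓ', h⟩ := (Submodule.mem_sSup_of_directed ⟨Γ₁, hΓ₁⟩ hdir).1 hx
        exact (le_sSup hΓ' : Γ' ≤ sSup c) ((hc hΓ').1 g x h)
      · obtain ⟨Γ', hΓ', h⟩ := (Submodule.mem_sSup_of_directed ⟨Γ₁, hΓ₁⟩ hdir).1 hx
        exact Submodule.disjoint_def.1 (hc hΓ').2 x h hxP) Γ₀ ⟨hΓ₀, hd₀⟩
  obtain ⟨hΓ, hd⟩ := hmax.prop
  refine ⟨Γ, hΓ, hle, hd, codisjoint_iff.2 (eq_top_iff.2 fun b _ => ?_)⟩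
  obtain ⟨w, hw, hdw⟩ := exists_translate hG hρ hΓ hP hd hadm b
  have h1 : Γ ⊔ orbitSpan ρ ⊤ {b - w} ≤ Γ := by
    refine hmax.le_of_ge ⟨fun g x hx => ?_, hdw⟩ le_sup_left
    obtain ⟨γ, hγ, y, hy, rfl⟩ := Submodule.mem_sup.1 hx
    rw [map_add]
    exact Submodule.add_mem_sup (hΓ g _ hγ) (apply_mem_orbitSpan (Subgroup.mem_top g) hy)
  have h2 : b - w ∈ Γ := h1 (Submodule.mem_sup_right (subset_orbitSpan _ _ rfl))
  have h3 := Submodule.add_mem_sup h2 hw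
  rwa [sub_add_cancel] at h3

end Complement

/-! ### Irreducible subspaces for compact open subgroups -/

section IrreducibleSpan

variable {G : Type*} [Group G] [TopologicalSpace G] {V : Type*} [AddCommGroup V] [Module ℂ V]
  {ρ : Representation ℂ G V}

/-- In an irreducible admissible representation, the vectors fixed by a compact open subgroup `K`
generate an irreducible representation of every sufficiently large compact open subgroup `L`: the
operators on the finite-dimensional space of `K`-fixed vectors induced by `ℂ[L]` exhaust those
induced by `ℂ[G]` once `L` is large. -/
theorem exists_irreducible_orbitSpan (hG : IsEllCGroup G) (hρ : IsSmoothRep ρ)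
    (hirr : ρ.IsIrreducible) {K : Subgroup G} (hK : IsCompactOpen K)
    (hadm : FiniteDimensional ℂ (fixedPts ρ K)) {B : Set G} (hB : IsCompact B) :
    ∃ L : Subgroup G, IsCompactOpen L ∧ K ≤ L ∧ B ⊆ L ∧ ∀ σ : Submodule ℂ V,
      σ ≤ orbitSpan ρ L (fixedPts ρ K) → (∀ g ∈ L, ∀ x ∈ σ, ρ g x ∈ σ) → σ ≠ ⊥ →
        σ = orbitSpan ρ L (fixedPts ρ K) := by
  have := hG.isTopologicalGroup
  set X : Submodule ℂ V := fixedPts ρ K with hX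
  have hKf := hρ.isLocallyFinite hK
  have heX : ∀ v, hKf.average v ∈ X := fun v =>
    mem_fixedPts.2 fun k hk => hKf.apply_average ⟨k, hk⟩ v
  -- the operator on `X` obtained by compressing an element of the group algebra
  let Φ : (G →₀ ℂ) →ₗ[ℂ] Module.End ℂ X :=
    (LinearMap.llcomp ℂ X V X (hKf.average.codRestrict X heX)) ∘ₗ
      (LinearMap.lcomp ℂ V X.subtype) ∘ₗ act ρ
  have hΦ : ∀ r (x : X), (Φ r x : V) = hKf.average (act ρ r x) := fun _ _ => rfl
  let A : Subgroup G → Submodule ℂ (Module.End ℂ X) := fun L =>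
    (Finsupp.supported ℂ ℂ (L : Set G)).map Φ
  have hAmono : ∀ L L' : Subgroup G, L ≤ L' → A L ≤ A L' := fun L L' h =>
    Submodule.map_mono (Finsupp.supported_mono h)
  obtain ⟨L₁, hL₁, hmax⟩ : ∃ L₁, IsCompactOpen L₁ ∧ ∀ L, IsCompactOpen L → ¬ A L₁ < A L := by
    obtain ⟨_, ⟨L₁, hL₁, rfl⟩, h⟩ := (wellFounded_gt (α := Submodule ℂ (Module.End ℂ X))).has_min
      (A '' {L | IsCompactOpen L}) ⟨_, K, hK, rfl⟩
    exact ⟨L₁, hL₁, fun L hL => h _ ⟨L, hL, rfl⟩⟩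
  have hle : ∀ L, IsCompactOpen L → A L ≤ A L₁ := by
    intro L hL
    obtain ⟨H, hH, h₁, h₂⟩ := hG.directed L₁ L hL₁ hL
    exact (hAmono _ _ h₂).trans ((hAmono _ _ h₁).eq_of_not_lt (hmax H hH)).ge
  obtain ⟨L₂, hL₂, hKL₂, hBL₂⟩ := hG.exists_ge_superset hK hB
  obtain ⟨L, hL, h₁, h₂⟩ := hG.directed L₁ L₂ hL₁ hL₂
  have hKL := hKL₂.trans h₂
  refine ⟨L, hL, hKL, hBL₂.trans h₂, fun σ hσ hσL hσ0 => le_antisymm hσ ?_⟩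
  obtain ⟨N, _, _, hN⟩ := (hρ.isLocallyFinite hL).exists_fixing_submodule X
  set τ : Representation ℂ L V := ρ.comp L.subtype with hτ
  have hYN : orbitSpan ρ L X ≤ fixedPts τ N :=
    orbitSpan_le (fun g hg a ha => apply_mem_fixedPts (ρ := τ) ha ⟨g, hg⟩) hN
  obtain ⟨p, hp, hp', hpe⟩ := exists_equivariant_projection (ρ := τ) N (A := σ)
    (fun g a ha => hσL g g.2 a ha) (hσ.trans hYN)
  -- `σ` contains a nonzero `K`-fixed vector, as otherwise the projection to `σ` would kill `X`
  obtain ⟨x, hxX, hx0⟩ : ∃ x ∈ X, p x ≠ 0 := by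
    by_contra! hcon
    apply hσ0
    have h3 : ∀ y ∈ orbitSpan ρ L X, p y = 0 := by
      have : orbitSpan ρ L X ≤ LinearMap.ker p := by
        refine Submodule.span_le.2 ?_
        rintro _ ⟨g, hg, x, hx, rfl⟩
        have h4 : p (ρ g x) = ρ g (p x) := hpe ⟨g, hg⟩ x (hN hx)
        change p (ρ g x) = 0
        rw [h4, hcon x hx, map_zero]
      exact this
    refine (Submodule.eq_bot_iff _).2 fun s hs => ?_
    rw [← hp' s hs, h3 s (hσ hs)]
  have hpxX : p x ∈ X := mem_fixedPts.2 fun k hk => by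
    have h4 : p (ρ k x) = ρ k (p x) := hpe ⟨k, hKL hk⟩ x (hN hxX)
    rw [← h4, mem_fixedPts.1 hxX k hk]
  refine orbitSpan_le hσL fun y hy => ?_
  obtain ⟨r, -, hr⟩ := exists_act_of_mem_orbitSpan
    (orbitSpan_eq_top_of_isIrreducible hirr hx0 ▸ Submodule.mem_top : y ∈ orbitSpan ρ ⊤ {p x})
  obtain ⟨H, hH, hrH⟩ := hG.exists_superset (r.support.finite_toSet.isCompact)
  obtain ⟨r', hr', hrr'⟩ := hAmono _ _ h₁ (hle H hH (Submodule.mem_map_of_mem (f := Φ) hrH))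
  have h5 : hKf.average (act ρ r' (p x)) = y := by
    have := congrArg Subtype.val (LinearMap.congr_fun hrr' ⟨p x, hpxX⟩)
    rw [hΦ, hΦ, hr] at this
    rw [this]
    exact hKf.average_of_fixed fun k => mem_fixedPts.1 hy k k.2
  rw [← h5]
  exact hKf.average_mem (fun g a ha => hσL g (hKL g.2) a ha)
    (act_mem (S := (L : Set G)) (fun g hg => hσL g hg _ (hp x)) hr')

end IrreducibleSpan

/-! ### Supports and radicals -/

section Category

variable {G : Type u} [Group G]

/-- The morphism of representations given by an equivariant linear map. -/
def homOfLinear {M N : Rep.{u} ℂ G} (f : M.V →ₗ[ℂ] N.V) (hf : ∀ g v, f (M.ρ g v) = N.ρ g (f v)) :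
    M ⟶ N :=
  Rep.ofHom ⟨f, fun g => LinearMap.ext (hf g)⟩

theorem hom_ext_apply {M N : Rep.{u} ℂ G} {f g : M ⟶ N} (h : ∀ v, f.hom v = g.hom v) : f = g := by
  ext v
  exact h v

theorem exists_apply_ne_zero {M N : Rep.{u} ℂ G} {f : M ⟶ N} (h : f ≠ 0) : ∃ v, f.hom v ≠ 0 := by
  by_contra! hcon
  exact h (hom_ext_apply fun v => by simpa using hcon v)

theorem ne_zero_of_apply {M N : Rep.{u} ℂ G} {f : M ⟶ N} {v : M.V} (h : f.hom v ≠ 0) : f ≠ 0 := by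
  rintro rfl
  simp at h

/-- The subrepresentation of `M` on a stable subspace. -/
abbrev subRep (M : Rep.{u} ℂ G) (A : Submodule ℂ M.V) (hA : ∀ g, ∀ x ∈ A, M.ρ g x ∈ A) :
    Rep.{u} ℂ G :=
  Rep.of (M.ρ.subrepresentation A hA)

/-- The inclusion of a subrepresentation. -/
def subRepι (M : Rep.{u} ℂ G) (A : Submodule ℂ M.V) (hA : ∀ g, ∀ x ∈ A, M.ρ g x ∈ A) :
    subRep M A hA ⟶ M :=
  homOfLinear A.subtype fun _ _ => rfl

theorem subRepι_injective {M : Rep.{u} ℂ G} {A : Submodule ℂ M.V}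
    (hA : ∀ g, ∀ x ∈ A, M.ρ g x ∈ A) : Function.Injective (subRepι M A hA).hom :=
  Subtype.val_injective

/-- The quotient of `M` by a stable subspace. -/
abbrev quotRep (M : Rep.{u} ℂ G) (A : Submodule ℂ M.V) (hA : ∀ g, ∀ x ∈ A, M.ρ g x ∈ A) :
    Rep.{u} ℂ G :=
  Rep.of (M.ρ.quotient A hA)

/-- The projection to a quotient representation. -/
def quotRepπ (M : Rep.{u} ℂ G) (A : Submodule ℂ M.V) (hA : ∀ g, ∀ x ∈ A, M.ρ g x ∈ A) :
    M ⟶ quotRep M A hA :=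
  homOfLinear A.mkQ fun _ _ => rfl

theorem quotRepπ_surjective {M : Rep.{u} ℂ G} {A : Submodule ℂ M.V}
    (hA : ∀ g, ∀ x ∈ A, M.ρ g x ∈ A) : Function.Surjective (quotRepπ M A hA).hom :=
  A.mkQ_surjective

theorem quotRepπ_eq_zero {M : Rep.{u} ℂ G} {A : Submodule ℂ M.V}
    (hA : ∀ g, ∀ x ∈ A, M.ρ g x ∈ A) {x : M.V} : (quotRepπ M A hA).hom x = 0 ↔ x ∈ A :=
  Submodule.Quotient.mk_eq_zero A

/-- A morphism that vanishes on a stable subspace factors through the quotient. -/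
def quotRepDesc {M N : Rep.{u} ℂ G} {A : Submodule ℂ M.V} (hA : ∀ g, ∀ x ∈ A, M.ρ g x ∈ A)
    (f : M ⟶ N) (hf : ∀ x ∈ A, f.hom x = 0) : quotRep M A hA ⟶ N :=
  homOfLinear (A.liftQ f.hom.toLinearMap hf) fun g v => by
    obtain ⟨m, rfl⟩ := A.mkQ_surjective v
    exact Rep.hom_comm_apply f g m

theorem quotRepDesc_apply {M N : Rep.{u} ℂ G} {A : Submodule ℂ M.V}
    (hA : ∀ g, ∀ x ∈ A, M.ρ g x ∈ A) (f : M ⟶ N) (hf : ∀ x ∈ A, f.hom x = 0) (x : M.V) :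
    (quotRepDesc hA f hf).hom ((quotRepπ M A hA).hom x) = f.hom x :=
  rfl

theorem quotRepπ_comp_desc {M N : Rep.{u} ℂ G} {A : Submodule ℂ M.V}
    (hA : ∀ g, ∀ x ∈ A, M.ρ g x ∈ A) (f : M ⟶ N) (hf : ∀ x ∈ A, f.hom x = 0) :
    quotRepπ M A hA ≫ quotRepDesc hA f hf = f :=
  hom_ext_apply fun _ => rfl

theorem epi_of_surjective {M N P : Rep.{u} ℂ G} {q : M ⟶ N} (hq : Function.Surjective q.hom)
    {f f' : N ⟶ P} (h : q ≫ f = q ≫ f') : f = f' :=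
  hom_ext_apply fun v => by
    obtain ⟨m, rfl⟩ := hq v
    exact congrArg (fun k : M ⟶ P => k.hom m) h

theorem range_stable {M N : Rep.{u} ℂ G} (f : M ⟶ N) :
    ∀ g, ∀ x ∈ LinearMap.range f.hom.toLinearMap, N.ρ g x ∈ LinearMap.range f.hom.toLinearMap := by
  rintro g _ ⟨x, rfl⟩
  exact ⟨M.ρ g x, Rep.hom_comm_apply f g x⟩

theorem ker_stable {M N : Rep.{u} ℂ G} (f : M ⟶ N) :
    ∀ g, ∀ x ∈ LinearMap.ker f.hom.toLinearMap, M.ρ g x ∈ LinearMap.ker f.hom.toLinearMap := by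
  intro g x hx
  have h : f.hom x = 0 := hx
  change f.hom (M.ρ g x) = 0
  rw [Rep.hom_comm_apply, h, map_zero]

theorem isIrreducible_of_forall {V : Type*} [AddCommGroup V] [Module ℂ V] [Nontrivial V]
    {ρ : Representation ℂ G V}
    (h : ∀ A : Submodule ℂ V, (∀ g, ∀ x ∈ A, ρ g x ∈ A) → A ≠ ⊥ → A = ⊤) : ρ.IsIrreducible where
  exists_pair_ne := ⟨⊥, ⊤, fun h => bot_ne_top (α := Submodule ℂ V)
    (congrArg Subrepresentation.toSubmodule h)⟩
  eq_bot_or_eq_top S := by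
    by_cases hS : S.toSubmodule = ⊥
    · exact Or.inl (Subrepresentation.toSubmodule_injective hS)
    · exact Or.inr (Subrepresentation.toSubmodule_injective
        (h _ (fun g x hx => S.apply_mem_toSubmodule g hx) hS))

end Category

section Support

variable {G : Type u} [Group G] [TopologicalSpace G]

theorem IsSmooth.of_injective {M N : Rep.{u} ℂ G} (hM : IsSmooth M) (j : N ⟶ M)
    (hj : Function.Injective j.hom) : IsSmooth N := fun v => by
  convert hM (j.hom v) using 3
  rw [← Rep.hom_comm_apply, hj.eq_iff]

theorem IsSmooth.of_surjective [IsTopologicalGroup G] {M N : Rep.{u} ℂ G} (hM : IsSmooth M)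
    (q : M ⟶ N) (hq : Function.Surjective q.hom) : IsSmooth N := fun v => by
  obtain ⟨m, rfl⟩ := hq v
  refine isOpen_stab_of_mem_fixedPts (ρ := N.ρ) (K := stab M.ρ m) (hM m)
    (mem_fixedPts.2 fun g hg => ?_)
  rw [← Rep.hom_comm_apply, show M.ρ g m = m from hg]

/-- Admissible representations are injective among the smooth ones. -/
theorem exists_extension (hG : IsEllCGroup G) {M N π : Rep.{u} ℂ G} (hM : IsSmooth M)
    (hπ : IsAdmissible π) (j : N ⟶ M) (hj : Function.Injective j.hom) (f : N ⟶ π) :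
    ∃ g : M ⟶ π, j ≫ g = f := by
  have := hG.isTopologicalGroup
  set ρ := M.ρ.prod π.ρ with hρdef
  have hρa : ∀ g x, ρ g x = (M.ρ g x.1, π.ρ g x.2) := fun _ _ => rfl
  have hρ : IsSmoothRep ρ := fun v => by
    have : {g | ρ g v = v} = {g | M.ρ g v.1 = v.1} ∩ {g | π.ρ g v.2 = v.2} := by
      ext g
      simp [hρa, Prod.ext_iff]
    rw [this]
    exact (hM _).inter (hπ.1 _)
  -- a complement of `0 × π` containing the graph of `f` over `j` is the graph of an extension
  obtain ⟨Γ, hΓ, hle, hc⟩ := exists_stable_isCompl hG hρ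
    (Γ₀ := LinearMap.range (j.hom.toLinearMap.prod f.hom.toLinearMap))
    (P := LinearMap.range (LinearMap.inr ℂ M.V π.V)) (by
      rintro g _ ⟨x, rfl⟩
      refine ⟨N.ρ g x, ?_⟩
      simp [hρa, Rep.hom_comm_apply]) (by
      rintro g _ ⟨x, rfl⟩
      exact ⟨π.ρ g x, by simp [hρa]⟩) (by
      refine Submodule.disjoint_def.2 ?_
      rintro _ ⟨x, rfl⟩ ⟨y, hy⟩
      have h1 : j.hom x = 0 := (congrArg Prod.fst hy).symm
      have h2 : x = 0 := hj (by rw [h1, map_zero])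
      rw [h2, map_zero]) (by
      intro K hK
      have := hπ.2 K hK
      refine Submodule.finiteDimensional_of_le
        (S₂ := (fixedPts π.ρ K).map (LinearMap.inr ℂ M.V π.V)) ?_
      rintro _ ⟨⟨y, rfl⟩, hy⟩
      refine ⟨y, mem_fixedPts.2 fun k hk => ?_, rfl⟩
      exact congrArg Prod.snd (mem_fixedPts.1 hy k hk))
  have huniq : ∀ m y y', (m, y) ∈ Γ → (m, y') ∈ Γ → y = y' := by
    intro m y y' h h'
    have h1 := Submodule.disjoint_def.1 hc.disjoint _ (sub_mem h h') ⟨y - y', by simp⟩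
    exact sub_eq_zero.1 (congrArg Prod.snd h1)
  have hex : ∀ m : M.V, ∃ y, (m, y) ∈ Γ := by
    intro m
    have h1 : ((m, 0) : M.V × π.V) ∈ Γ ⊔ LinearMap.range (LinearMap.inr ℂ M.V π.V) := by
      rw [hc.sup_eq_top]
      exact Submodule.mem_top
    obtain ⟨⟨m', y⟩, hγ, _, ⟨z, rfl⟩, h⟩ := Submodule.mem_sup.1 h1
    have h2 : m' = m := by simpa using congrArg Prod.fst h
    exact ⟨y, h2 ▸ hγ⟩
  choose e he using hex
  refine ⟨homOfLinear
    { toFun := e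
      map_add' := fun m m' => huniq _ _ _ (he _) (add_mem (he m) (he m'))
      map_smul' := fun c m => huniq _ _ _ (he _) (Γ.smul_mem c (he m)) }
    fun g m => huniq _ _ _ (he _) (hΓ g _ (he m)), hom_ext_apply fun x => ?_⟩
  exact huniq _ _ _ (he _) (hle ⟨x, rfl⟩)

theorem supp_subset_of_injective (hG : IsEllCGroup G) (hT : IsTame G) {M N : Rep.{u} ℂ G}
    (hM : IsSmooth M) (j : N ⟶ M) (hj : Function.Injective j.hom) : supp N ⊆ supp M := by
  rintro _ ⟨π, rfl, f, hf⟩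
  obtain ⟨g, rfl⟩ := exists_extension hG hM (hT π) j hj f
  obtain ⟨v, hv⟩ := exists_apply_ne_zero hf
  exact ⟨π, rfl, g, ne_zero_of_apply (v := j.hom v) hv⟩

theorem supp_subset_of_surjective {M N : Rep.{u} ℂ G} (q : M ⟶ N)
    (hq : Function.Surjective q.hom) : supp N ⊆ supp M := by
  rintro _ ⟨π, rfl, f, hf⟩
  obtain ⟨v, hv⟩ := exists_apply_ne_zero hf
  obtain ⟨m, rfl⟩ := hq v
  exact ⟨π, rfl, q ≫ f, ne_zero_of_apply (v := m) hv⟩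

/-- The maps to irreducible representations separate the vectors of a smooth representation: modulo
a maximal stable subspace avoiding `m`, the vector `m` generates an irreducible subrepresentation,
which splits off. -/
theorem exists_irreducible_quotient (hG : IsEllCGroup G) (hT : IsTame G) {M : Rep.{u} ℂ G}
    (hM : IsSmooth M) {m : M.V} (hm : m ≠ 0) : ∃ (π : Irr G) (f : M ⟶ π.obj), f.hom m ≠ 0 := by
  have := hG.isTopologicalGroup
  obtain ⟨Γ, -, hmax⟩ := zorn_le_nonempty₀
    {Γ : Submodule ℂ M.V | (∀ g, ∀ x ∈ Γ, M.ρ g x ∈ Γ) ∧ m ∉ Γ} (by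
      intro c hc hchain Γ₁ hΓ₁
      have hdir := hchain.directedOn
      refine ⟨sSup c, ⟨fun g x hx => ?_, fun hx => ?_⟩, fun z hz => le_sSup hz⟩
      · obtain ⟨Γ', hΓ', h⟩ := (Submodule.mem_sSup_of_directed ⟨Γ₁, hΓ₁⟩ hdir).1 hx
        exact (le_sSup hΓ' : Γ' ≤ sSup c) ((hc hΓ').1 g x h)
      · obtain ⟨Γ', hΓ', h⟩ := (Submodule.mem_sSup_of_directed ⟨Γ₁, hΓ₁⟩ hdir).1 hx
        exact (hc hΓ').2 h) ⊥ ⟨fun g x hx => by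
          rw [(Submodule.mem_bot ℂ).1 hx, map_zero]; exact zero_mem _, by simpa using hm⟩
  obtain ⟨hΓ, hmΓ⟩ := hmax.prop
  set Q := quotRep M Γ hΓ with hQ
  set q := quotRepπ M Γ hΓ with hq
  have hQs : IsSmooth Q := hM.of_surjective q (quotRepπ_surjective hΓ)
  have hqm : q.hom m ≠ 0 := fun h => hmΓ ((quotRepπ_eq_zero hΓ).1 h)
  have hPst : ∀ g, ∀ x ∈ orbitSpan Q.ρ ⊤ {q.hom m}, Q.ρ g x ∈ orbitSpan Q.ρ ⊤ {q.hom m} :=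
    fun g x hx => apply_mem_orbitSpan (Subgroup.mem_top g) hx
  have hmP : q.hom m ∈ orbitSpan Q.ρ ⊤ {q.hom m} := subset_orbitSpan _ _ rfl
  -- every nonzero stable subspace of the quotient contains the image of `m`
  have hmin : ∀ A : Submodule ℂ Q.V, (∀ g, ∀ x ∈ A, Q.ρ g x ∈ A) → A ≠ ⊥ → q.hom m ∈ A := by
    intro A hA hA0
    by_contra hmA
    refine hA0 ((Submodule.eq_bot_iff _).2 fun x hx => ?_)
    obtain ⟨y, rfl⟩ := quotRepπ_surjective hΓ x
    have hle : A.comap q.hom.toLinearMap ≤ Γ := by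
      refine hmax.le_of_ge ⟨fun g z hz => ?_, hmA⟩ fun z hz => ?_
      · change q.hom (M.ρ g z) ∈ A
        rw [Rep.hom_comm_apply]
        exact hA g _ hz
      · change q.hom z ∈ A
        rw [(quotRepπ_eq_zero hΓ).2 hz]
        exact zero_mem _
    exact (quotRepπ_eq_zero hΓ).2 (hle hx)
  let P := subRep Q _ hPst
  have hirr : P.ρ.IsIrreducible := by
    have : Nontrivial (orbitSpan Q.ρ ⊤ {q.hom m}) := ⟨⟨⟨_, hmP⟩, 0, fun h => hqm
      (congrArg Subtype.val h)⟩⟩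
    refine isIrreducible_of_forall fun A hA hA0 => ?_
    have h1 := hmin (A.map (Submodule.subtype _)) (by
      rintro g _ ⟨x, hx, rfl⟩
      exact ⟨_, hA g x hx, rfl⟩) (fun h => hA0
        (Submodule.map_injective_of_injective (f := Submodule.subtype _) Subtype.val_injective
          (h.trans (Submodule.map_bot _).symm)))
    have h2 : orbitSpan Q.ρ ⊤ {q.hom m} ≤ A.map (Submodule.subtype _) := by
      refine orbitSpan_le ?_ (Set.singleton_subset_iff.2 h1)
      rintro g - _ ⟨x, hx, rfl⟩
      exact ⟨_, hA g x hx, rfl⟩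
    refine eq_top_iff.2 fun x _ => ?_
    obtain ⟨y, hy, hyx⟩ := h2 x.2
    exact (Subtype.ext hyx : y = x) ▸ hy
  let π : Irr G := ⟨P, hQs.of_injective (subRepι Q _ hPst) (subRepι_injective hPst), hirr⟩
  obtain ⟨g, hg⟩ := exists_extension hG hQs (hT π) (subRepι Q _ hPst) (subRepι_injective hPst) (𝟙 P)
  refine ⟨π, q ≫ g, fun h => hqm ?_⟩
  have h1 : g.hom (q.hom m) = (⟨_, hmP⟩ : orbitSpan Q.ρ ⊤ {q.hom m}) :=
    congrArg (fun k : P ⟶ P => k.hom ⟨_, hmP⟩) hg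
  have h2 : g.hom (q.hom m) = 0 := h
  exact congrArg Subtype.val (h1.symm.trans h2)

/-- The intersection of the kernels of all maps from `M` to irreducible representations in `C`. -/
def radical (C : Set (SmoothDual G)) (M : Rep.{u} ℂ G) : Submodule ℂ M.V :=
  ⨅ (π : Irr G) (_ : π.cls ∈ C) (f : M ⟶ π.obj), LinearMap.ker f.hom.toLinearMap

variable {C : Set (SmoothDual G)}

theorem mem_radical {M : Rep.{u} ℂ G} {x : M.V} :
    x ∈ radical C M ↔ ∀ π : Irr G, π.cls ∈ C → ∀ f : M ⟶ π.obj, f.hom x = 0 := by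
  simp only [radical, Submodule.mem_iInf]
  rfl

theorem map_mem_radical {M N : Rep.{u} ℂ G} (h : M ⟶ N) {x : M.V} (hx : x ∈ radical C M) :
    h.hom x ∈ radical C N :=
  mem_radical.2 fun π hπ f => mem_radical.1 hx π hπ (h ≫ f)

theorem radical_stable (C : Set (SmoothDual G)) (M : Rep.{u} ℂ G) :
    ∀ g, ∀ x ∈ radical C M, M.ρ g x ∈ radical C M := fun g x hx =>
  mem_radical.2 fun π hπ f => by rw [Rep.hom_comm_apply, mem_radical.1 hx π hπ f, map_zero]

theorem eq_zero_of_mem_radical (hG : IsEllCGroup G) (hT : IsTame G) {M : Rep.{u} ℂ G}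
    (hM : IsSmooth M) (hC : supp M ⊆ C) {x : M.V} (hx : x ∈ radical C M) : x = 0 := by
  by_contra h0
  obtain ⟨π, f, hf⟩ := exists_irreducible_quotient hG hT hM h0
  exact hf (mem_radical.1 hx π (hC ⟨π, rfl, f, ne_zero_of_apply hf⟩) f)

end Support

/-! ### Radicals of closed sets -/

section HullKernel

variable {G : Type u} [Group G] [TopologicalSpace G] {C : Set (SmoothDual G)}

/-- Closed sets of the smooth dual are recovered from their radicals: an irreducible quotient `π` of
`M` that vanishes on the radical of a closed set `C` belongs to `C`. Otherwise a Fell neighbourhood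
of `π` misses `C`, and its vectors lie in an irreducible subspace `Y` of `π` for a compact open
subgroup `L` containing its compact set. Maschke's theorem lifts `Y` to an `L`-subspace of `M` not
contained in the radical, so that some member of `C` contains a copy of `Y`, hence realizes on `L`
the same matrix coefficients as `π`. -/
theorem cls_mem_of_radical_le_ker (hG : IsEllCGroup G) (hT : IsTame G) (hC : IsClosed C)
    {M : Rep.{u} ℂ G} (hM : IsSmooth M) {π : Irr G} {f : M ⟶ π.obj} (hf : f ≠ 0)
    (hrad : ∀ x ∈ radical C M, f.hom x = 0) : π.cls ∈ C := by
  have := hG.isTopologicalGroup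
  by_contra hπ
  obtain ⟨n, v, ξ, B, ε, -, hB, hε, hsub⟩ : ContainsFellNhd π Cᶜ := hC.isOpen_compl π hπ
  obtain ⟨m, hm⟩ := exists_apply_ne_zero hf
  have hMs : IsSmoothRep M.ρ := hM
  have hπs : IsSmoothRep π.obj.ρ := π.property.1
  classical
  obtain ⟨K, hK, hKv⟩ := hπs.exists_fixing hG (insert (f.hom m) (Finset.univ.image v))
  obtain ⟨L, hL, hKL, hBL, hY⟩ := exists_irreducible_orbitSpan hG hπs π.property.2 hK
    ((hT π).2 K hK) hB
  set Y := orbitSpan π.obj.ρ L (fixedPts π.obj.ρ K) with hYdef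
  have hXY : ∀ x ∈ fixedPts π.obj.ρ K, x ∈ Y := subset_orbitSpan _ _
  obtain ⟨N, _, _, hN, hmN⟩ := hMs.exists_normal_fixing hL m
  set τ : Representation ℂ L M.V := M.ρ.comp L.subtype with hτ
  have hτs : ∀ g ∈ L, ∀ x ∈ fixedPts τ N, M.ρ g x ∈ fixedPts τ N := fun g hg x hx =>
    apply_mem_fixedPts (ρ := τ) hx ⟨g, hg⟩
  obtain ⟨p, hp, hp', hpe⟩ := exists_equivariant_projection (ρ := τ) N
    (A := LinearMap.ker f.hom.toLinearMap ⊓ fixedPts τ N)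
    (fun g a ha => ⟨ker_stable f g a ha.1, hτs g g.2 a ha.2⟩) inf_le_right
  -- the subspace of `M` that `f` maps isomorphically onto `Y`
  let N₁ : Submodule ℂ M.V :=
    LinearMap.ker p ⊓ (fixedPts τ N ⊓ Y.comap f.hom.toLinearMap)
  have hN₁ : ∀ x, x ∈ N₁ ↔ p x = 0 ∧ x ∈ fixedPts τ N ∧ f.hom x ∈ Y := fun _ => Iff.rfl
  have hN₁s : ∀ g ∈ L, ∀ x ∈ N₁, M.ρ g x ∈ N₁ := by
    intro g hg x hx
    obtain ⟨h1, h2, h3⟩ := (hN₁ x).1 hx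
    refine (hN₁ _).2 ⟨?_, hτs g hg x h2, ?_⟩
    · have h4 : p (M.ρ g x) = M.ρ g (p x) := hpe ⟨g, hg⟩ x h2
      rw [h4, h1, map_zero]
    · rw [Rep.hom_comm_apply]
      exact apply_mem_orbitSpan hg h3
  have hinj : ∀ x ∈ N₁, f.hom x = 0 → x = 0 := by
    intro x hx h0
    obtain ⟨h1, h2, -⟩ := (hN₁ x).1 hx
    rw [← hp' x ⟨h0, h2⟩, h1]
  have hfp : ∀ x, f.hom (p x) = 0 := fun x => (hp x).1
  have hm₁ : m - p m ∈ N₁ := by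
    refine (hN₁ _).2 ⟨?_, sub_mem hmN (hp m).2, ?_⟩
    · rw [map_sub, hp' _ (hp m), sub_self]
    · rw [map_sub, hfp, sub_zero]
      exact hXY _ (hKv _ (Finset.mem_insert_self _ _))
  have hfm₁ : f.hom (m - p m) ≠ 0 := by rwa [map_sub, hfp, sub_zero]
  -- the image under `f` of a nonzero `L`-stable subspace of `N₁` is the whole of `Y`
  have himage : ∀ D : Submodule ℂ M.V, D ≤ N₁ → (∀ g ∈ L, ∀ x ∈ D, M.ρ g x ∈ D) →
      ∀ x ∈ D, x ≠ 0 → ∀ y ∈ Y, ∃ u ∈ D, f.hom u = y := by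
    intro D hD hDs x hx hx0 y hy
    have h1 := hY (D.map f.hom.toLinearMap) (by
      rintro _ ⟨u, hu, rfl⟩
      exact ((hN₁ u).1 (hD hu)).2.2) (by
      rintro g hg _ ⟨u, hu, rfl⟩
      exact ⟨_, hDs g hg u hu, Rep.hom_comm_apply f g u⟩) (fun h => by
      have h2 : f.hom x ∈ (⊥ : Submodule ℂ π.obj.V) := h ▸ Submodule.mem_map_of_mem hx
      exact hx0 (hinj x (hD hx) h2))
    have h2 : y ∈ D.map f.hom.toLinearMap := h1 ▸ hy
    exact h2
  have hm₁0 : m - p m ≠ 0 := fun h => hfm₁ (by rw [h, map_zero])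
  obtain ⟨σ, hσ, k, hk⟩ : ∃ σ : Irr G, σ.cls ∈ C ∧ ∃ k : M ⟶ σ.obj, k.hom (m - p m) ≠ 0 := by
    by_contra! hcon
    exact hfm₁ (hrad _ (mem_radical.2 hcon))
  have hkinj : ∀ x ∈ N₁, k.hom x = 0 → x = 0 := by
    intro x hx hkx
    by_contra hx0
    obtain ⟨u, ⟨hu, hku⟩, hfu⟩ := himage (N₁ ⊓ LinearMap.ker k.hom.toLinearMap) inf_le_left
      (fun g hg x hx => ⟨hN₁s g hg x hx.1, ker_stable k g x hx.2⟩) x ⟨hx, hkx⟩ hx0 _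
      ((hN₁ _).1 hm₁).2.2
    have h1 : u - (m - p m) = 0 := hinj _ (sub_mem hu hm₁) (by rw [map_sub, hfu, sub_self])
    exact hk (sub_eq_zero.1 h1 ▸ hku)
  obtain ⟨θ, hθ⟩ : ∃ θ : σ.obj.V →ₗ[ℂ] π.obj.V, ∀ x ∈ N₁, θ (k.hom x) = f.hom x := by
    obtain ⟨s, hs⟩ := (k.hom.toLinearMap ∘ₗ N₁.subtype).exists_leftInverse_of_injective
      (LinearMap.ker_eq_bot'.2 fun x hx => Subtype.ext (hkinj x x.2 hx))
    refine ⟨f.hom.toLinearMap ∘ₗ N₁.subtype ∘ₗ s, fun x hx => ?_⟩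
    have h1 : s (k.hom x) = ⟨x, hx⟩ := LinearMap.congr_fun hs ⟨x, hx⟩
    change f.hom (s (k.hom x)).1 = _
    rw [h1]
  choose u hu hfu using fun j => himage N₁ le_rfl hN₁s _ hm₁ hm₁0 (v j)
    (hXY _ (hKv _ (Finset.mem_insert_of_mem (Finset.mem_image_of_mem v (Finset.mem_univ j)))))
  set H : Subgroup G := N.map L.subtype with hHdef
  have hσs : IsSmoothRep σ.obj.ρ := σ.property.1
  have hav := hσs.isLocallyFinite hN
  refine hsub ⟨σ, rfl, fun j => k.hom (u j), fun j => ξ j ∘ₗ θ ∘ₗ hav.average,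
    fun j => ?_, fun j g hg => ?_⟩ hσ
  · -- averaging over `H` makes the functional smooth
    refine isOpen_stab_of_mem_fixedPts (ρ := σ.obj.ρ.dual) hN.2 (mem_fixedPts.2 fun h hh => ?_)
    ext x
    have h1 := hav.average_apply ⟨h⁻¹, inv_mem hh⟩ x
    exact congrArg (fun y => ξ j (θ y)) h1
  · have h1 := hN₁s g (hBL hg) _ (hu j)
    have h2 : hav.average (k.hom (M.ρ g (u j))) = k.hom (M.ρ g (u j)) := by
      refine hav.average_of_fixed ?_
      rintro ⟨_, ⟨a, ha, rfl⟩⟩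
      have h3 := mem_fixedPts.1 ((hN₁ _).1 h1).2.1 a ha
      change σ.obj.ρ a (k.hom (M.ρ g (u j))) = _
      rw [← Rep.hom_comm_apply]
      exact congrArg k.hom h3
    have h3 : (ξ j ∘ₗ θ ∘ₗ hav.average) (σ.obj.ρ g (k.hom (u j))) = ξ j (π.obj.ρ g (v j)) := by
      rw [← Rep.hom_comm_apply, LinearMap.comp_apply, LinearMap.comp_apply, h2, hθ _ h1,
        Rep.hom_comm_apply, hfu]
    rw [h3, sub_self, norm_zero]
    exact hε

theorem supp_quot_radical_subset (hG : IsEllCGroup G) (hT : IsTame G) (hC : IsClosed C)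
    {M : Rep.{u} ℂ G} (hM : IsSmooth M) :
    supp (quotRep M (radical C M) (radical_stable C M)) ⊆ C := by
  rintro _ ⟨π, rfl, f, hf⟩
  refine cls_mem_of_radical_le_ker hG hT hC hM (f := quotRepπ M _ (radical_stable C M) ≫ f) ?_ ?_
  · obtain ⟨x, hx⟩ := exists_apply_ne_zero hf
    obtain ⟨m, rfl⟩ := quotRepπ_surjective _ x
    exact ne_zero_of_apply (v := m) hx
  · intro x hx
    change f.hom ((quotRepπ M _ (radical_stable C M)).hom x) = 0
    rw [(quotRepπ_eq_zero _).2 hx, map_zero]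

end HullKernel

/-! ### The representations `ℂ[G ⧸ K]` and open sets of the smooth dual -/

section CosetRep

variable {G : Type u} [Group G]

/-- The permutation representation on finitely supported functions on `G ⧸ K`. -/
noncomputable def cosetRepresentation (K : Subgroup G) : Representation ℂ G ((G ⧸ K) →₀ ℂ) where
  toFun g := Finsupp.lmapDomain ℂ ℂ fun c : G ⧸ K => g • c
  map_one' := Finsupp.lhom_ext fun c a => by simp [Finsupp.mapDomain_single]
  map_mul' g h := Finsupp.lhom_ext fun c a => by simp [Finsupp.mapDomain_single, mul_smul]

/-- The permutation representation on `G ⧸ K` as an object of the category of representations; it is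
generated freely by a `K`-fixed vector. -/
noncomputable abbrev cosetRep (K : Subgroup G) : Rep.{u} ℂ G :=
  Rep.of (cosetRepresentation K)

theorem cosetRep_single (K : Subgroup G) (g : G) (c : G ⧸ K) (a : ℂ) :
    (cosetRep K).ρ g (Finsupp.single c a) = Finsupp.single (g • c) a :=
  Finsupp.mapDomain_single

/-- The morphism from `cosetRep K` determined by a `K`-fixed vector. -/
noncomputable def cosetLift {K : Subgroup G} {M : Rep.{u} ℂ G} (w : M.V)
    (hw : w ∈ fixedPts M.ρ K) : cosetRep K ⟶ M :=
  homOfLinear (Finsupp.linearCombination ℂ fun c : G ⧸ K => M.ρ c.out w) fun g v => by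
    induction v using Finsupp.induction_linear with
    | zero => simp
    | add x y hx hy => simp only [map_add, hx, hy]
    | single c a =>
      obtain ⟨h, rfl⟩ := QuotientGroup.mk_surjective c
      have key : ∀ h : G, M.ρ (h : G ⧸ K).out w = M.ρ h w :=
        apply_out_of_rightInvariant (F := fun g => M.ρ g w) (orbit_right_inv hw)
      rw [cosetRep_single, Finsupp.linearCombination_single, Finsupp.linearCombination_single,
        key h, map_smul]
      change a • M.ρ ((g * h : G) : G ⧸ K).out w = _
      rw [key, map_mul, Module.End.mul_apply]

theorem cosetLift_apply {K : Subgroup G} {M : Rep.{u} ℂ G} (w : M.V) (hw : w ∈ fixedPts M.ρ K)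
    (x : (G ⧸ K) →₀ ℂ) :
    (cosetLift w hw).hom x = ∑ c ∈ x.support, x c • M.ρ c.out w :=
  rfl

theorem cosetLift_single_one {K : Subgroup G} {M : Rep.{u} ℂ G} (w : M.V)
    (hw : w ∈ fixedPts M.ρ K) :
    (cosetLift w hw).hom (Finsupp.single ((1 : G) : G ⧸ K) 1) = w := by
  change Finsupp.linearCombination ℂ (fun c : G ⧸ K => M.ρ c.out w) _ = w
  rw [Finsupp.linearCombination_single, one_smul]
  exact (apply_out_of_rightInvariant (F := fun g => M.ρ g w) (orbit_right_inv hw) 1).trans (by simp)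

variable [TopologicalSpace G]

theorem isSmooth_cosetRep [IsTopologicalGroup G] {K : Subgroup G} (hK : IsOpen (K : Set G)) :
    IsSmooth (cosetRep K) := by
  intro v
  induction v using Finsupp.induction_linear with
  | zero => simp
  | add x y hx hy =>
    refine isOpen_stab_of_mem_fixedPts (ρ := (cosetRep K).ρ)
      (K := stab (cosetRep K).ρ x ⊓ stab (cosetRep K).ρ y) (hx.inter hy)
      (mem_fixedPts.2 fun g hg => ?_)
    rw [map_add, show (cosetRep K).ρ g x = x from hg.1, show (cosetRep K).ρ g y = y from hg.2]
  | single c a =>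
    obtain ⟨h, rfl⟩ := QuotientGroup.mk_surjective c
    refine isOpen_stab_of_mem_fixedPts (ρ := (cosetRep K).ρ)
      (K := K.comap (MulAut.conj h⁻¹).toMonoidHom) (hK.preimage ?_)
      (mem_fixedPts.2 fun g hg => ?_)
    · change Continuous fun g => h⁻¹ * g * h⁻¹⁻¹
      fun_prop
    · rw [cosetRep_single]
      congr 1
      refine (QuotientGroup.eq.2 ?_).symm
      have : h⁻¹ * g * h⁻¹⁻¹ ∈ K := hg
      simpa [mul_assoc] using this

theorem exists_smoothFunctional_ne_zero (hG : IsEllCGroup G) {M : Rep.{u} ℂ G} (hM : IsSmooth M)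
    {v : M.V} (hv : v ≠ 0) : ∃ ξ : Module.Dual ℂ M.V, IsSmoothFunctional M ξ ∧ ξ v ≠ 0 := by
  have := hG.isTopologicalGroup
  have hMs : IsSmoothRep M.ρ := hM
  obtain ⟨K, hK, hKv⟩ := hMs.exists_fixing hG {v}
  replace hKv := hKv v (by simp)
  have hav := hMs.isLocallyFinite hK
  obtain ⟨ξ, hξ⟩ : ∃ ξ : Module.Dual ℂ M.V, ξ v ≠ 0 := by
    by_contra! hcon
    exact hv ((Module.forall_dual_apply_eq_zero_iff ℂ v).1 hcon)
  refine ⟨ξ ∘ₗ hav.average, ?_, ?_⟩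
  · refine isOpen_stab_of_mem_fixedPts (ρ := M.ρ.dual) hK.2 (mem_fixedPts.2 fun h hh => ?_)
    ext x
    have h1 := hav.average_apply ⟨h⁻¹, inv_mem hh⟩ x
    exact congrArg ξ h1
  · rw [LinearMap.comp_apply, hav.average_of_fixed fun k => mem_fixedPts.1 hKv k k.2]
    exact hξ

/-- If a smooth functional detects `x • v` for a `K`-fixed vector `v`, any approximation of the
corresponding matrix coefficient on the support of `x` yields, after averaging over `K`, a
`K`-fixed vector not killed by `x`. -/
theorem containsFellNhd_of_cosetLift_ne_zero (hG : IsEllCGroup G) {K : Subgroup G}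
    (hK : IsCompactOpen K) (x : (G ⧸ K) →₀ ℂ) {π : Irr G} {v : π.obj.V}
    (hv : v ∈ fixedPts π.obj.ρ K) (hx : (cosetLift v hv).hom x ≠ 0) :
    ContainsFellNhd π {c | ∃ σ : Irr G, σ.cls = c ∧ ∃ (w : σ.obj.V) (hw : w ∈ fixedPts σ.obj.ρ K),
      (cosetLift w hw).hom x ≠ 0} := by
  have := hG.isTopologicalGroup
  obtain ⟨ξ, hξ, hξx⟩ := exists_smoothFunctional_ne_zero hG π.property.1 hx
  set R : ℝ := ∑ c ∈ x.support, ‖x c‖ with hR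
  have hR0 : 0 ≤ R := Finset.sum_nonneg fun _ _ => norm_nonneg _
  set ε : ℝ := ‖ξ ((cosetLift v hv).hom x)‖ / (R + 1) with hε
  have hε0 : 0 < ε := div_pos (norm_pos_iff.2 hξx) (by linarith)
  have hεR : ε * R < ‖ξ ((cosetLift v hv).hom x)‖ := by
    have h1 : ε * (R + 1) = ‖ξ ((cosetLift v hv).hom x)‖ := div_mul_cancel₀ _ (by linarith)
    nlinarith
  refine ⟨1, fun _ => v, fun _ => ξ, ⋃ c ∈ x.support, (fun k => c.out * k) '' (K : Set G), ε,
    fun _ => hξ, x.support.finite_toSet.isCompact_biUnion fun c _ =>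
      hK.1.image (continuous_const_mul _), hε0, ?_⟩
  rintro _ ⟨σ, rfl, w, ζ, -, hw⟩
  replace hw := hw 0
  have hσs : IsSmoothRep σ.obj.ρ := σ.property.1
  have hav := hσs.isLocallyFinite hK
  have hwK : hav.average (w 0) ∈ fixedPts σ.obj.ρ K :=
    mem_fixedPts.2 fun k hk => hav.apply_average ⟨k, hk⟩ _
  refine ⟨σ, rfl, hav.average (w 0), hwK, fun h0 => ?_⟩
  obtain ⟨N, _, _, hN⟩ := hav (w 0)
  have hclose : ∀ c ∈ x.support,
      ‖ξ (π.obj.ρ c.out v) - ζ 0 (σ.obj.ρ c.out (hav.average (w 0)))‖ < ε := by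
    intro c hc
    have h1 : ζ 0 (σ.obj.ρ c.out (hav.average (w 0))) =
        cosetAvg N fun k : K => ζ 0 (σ.obj.ρ c.out (σ.obj.ρ k (w 0))) := by
      rw [hav.average_eq N hN]
      exact map_cosetAvg (ζ 0 ∘ₗ σ.obj.ρ c.out) fun k : K => σ.obj.ρ k (w 0)
    rw [h1, ← cosetAvg_const (N := N) (ξ (π.obj.ρ c.out v)), ← cosetAvg_sub]
    refine norm_cosetAvg_lt fun k => ?_
    have h2 := hw (c.out * k) (Set.mem_biUnion hc ⟨k, k.2, rfl⟩)
    rwa [map_mul, map_mul, Module.End.mul_apply, Module.End.mul_apply,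
      mem_fixedPts.1 hv k k.2] at h2
  have h3 : ξ ((cosetLift v hv).hom x) = ∑ c ∈ x.support,
      x c * (ξ (π.obj.ρ c.out v) - ζ 0 (σ.obj.ρ c.out (hav.average (w 0)))) := by
    have h4 : ζ 0 ((cosetLift _ hwK).hom x) = 0 := by rw [h0, map_zero]
    rw [← sub_zero (ξ _), ← h4, cosetLift_apply, cosetLift_apply, map_sum, map_sum,
      ← Finset.sum_sub_distrib]
    simp only [map_smul, smul_eq_mul, mul_sub]
  have h5 : ‖ξ ((cosetLift v hv).hom x)‖ ≤ ε * R := by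
    rw [h3, hR, Finset.mul_sum]
    refine (norm_sum_le _ _).trans (Finset.sum_le_sum fun c hc => ?_)
    rw [norm_mul, mul_comm]
    exact mul_le_mul_of_nonneg_right (hclose c hc).le (norm_nonneg _)
  linarith

/-- The irreducible representations in which an element of `ℂ[G ⧸ K]` does not annihilate the
`K`-fixed vectors form an open set. -/
theorem isOpen_cosetLift_ne_zero (hG : IsEllCGroup G) {K : Subgroup G} (hK : IsCompactOpen K)
    (x : (G ⧸ K) →₀ ℂ) : IsOpen {c | ∃ σ : Irr G, σ.cls = c ∧ ∃ (w : σ.obj.V)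
      (hw : w ∈ fixedPts σ.obj.ρ K), (cosetLift w hw).hom x ≠ 0} := by
  intro π hπ
  obtain ⟨σ, hσ, w, hw, hx⟩ := hπ
  obtain ⟨e⟩ : Nonempty (σ ≅ π) := Quotient.exact hσ
  have hw' : e.hom.hom.hom w ∈ fixedPts π.obj.ρ K := mem_fixedPts.2 fun k hk => by
    rw [← Rep.hom_comm_apply, mem_fixedPts.1 hw k hk]
  refine containsFellNhd_of_cosetLift_ne_zero hG hK x hw' fun h => hx ?_
  have h1 : (cosetLift _ hw').hom x = e.hom.hom.hom ((cosetLift w hw).hom x) := by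
    rw [cosetLift_apply, cosetLift_apply, map_sum]
    refine Finset.sum_congr rfl fun c _ => ?_
    rw [map_smul, Rep.hom_comm_apply]
  have h2 : e.inv.hom.hom (e.hom.hom.hom ((cosetLift w hw).hom x)) = (cosetLift w hw).hom x :=
    congrArg (fun k : σ ⟶ σ => k.hom.hom ((cosetLift w hw).hom x)) e.hom_inv_id
  rw [← h2, ← h1, h, map_zero]

end CosetRep

/-! ### The adjunction -/

section Adjoint

variable {G : Type u} [Group G] [TopologicalSpace G]

theorem supp_irreducible_subset (π : Irr G) : supp π.obj ⊆ {π.cls} := by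
  rintro _ ⟨σ, rfl, f, hf⟩
  have := π.property.2
  have := σ.property.2
  rcases Representation.IsIrreducible.bijective_or_eq_zero f.hom with h | h
  · exact Quotient.sound ⟨(ObjectProperty.isoMk _
      (Rep.mkIso (Representation.IntertwiningMap.ofBijective f.hom h))).symm⟩
  · exact absurd (Rep.hom_ext h) hf

/-- An irreducible representation with class in `S`, as an object of `R(G)_S`. -/
def Irr.toSmoothRepOn {S : Set (SmoothDual G)} (π : Irr G) (h : π.cls ∈ S) : SmoothRepOn S :=
  ⟨π.obj, π.property.1, (supp_irreducible_subset π).trans (Set.singleton_subset_iff.2 h)⟩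

section Quotient

variable {W Z C : Set (SmoothDual G)}

/-- The largest quotient of `M` with support in the closed set `C`, as an object of `R(G)_Z` for
`Z ⊇ W ∩ C`. -/
def radicalQuotient (hG : IsEllCGroup G) (hT : IsTame G) (hC : IsClosed C) (hZ : W ∩ C ⊆ Z)
    (M : SmoothRepOn W) : SmoothRepOn Z :=
  ⟨quotRep M.obj (radical C M.obj) (radical_stable C M.obj),
    have := hG.isTopologicalGroup
    M.property.1.of_surjective (quotRepπ M.obj _ _) (quotRepπ_surjective _),
    fun _ hx => hZ ⟨M.property.2 (supp_subset_of_surjective _ (quotRepπ_surjective _) hx),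
      supp_quot_radical_subset hG hT hC M.property.1 hx⟩⟩

/-- The projection of `M` onto its largest quotient with support in `C`. -/
def toRadicalQuotient (hG : IsEllCGroup G) (hT : IsTame G) (hC : IsClosed C) (hZ : W ∩ C ⊆ Z)
    (hZW : Z ⊆ W) (M : SmoothRepOn W) :
    M ⟶ (inclusion hZW).obj (radicalQuotient hG hT hC hZ M) :=
  ObjectProperty.homMk (quotRepπ M.obj (radical C M.obj) (radical_stable C M.obj))

theorem isRightAdjoint_inclusion (hG : IsEllCGroup G) (hT : IsTame G) (hC : IsClosed C)
    (hZ : W ∩ C ⊆ Z) (hZW : Z ⊆ W) (hZC : Z ⊆ C) : (inclusion hZW).IsRightAdjoint := by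
  refine isRightAdjoint_iff_hasInitial_structuredArrow.2 fun M => ?_
  refine (Limits.IsInitial.ofUniqueHom (X := StructuredArrow.mk
    (toRadicalQuotient hG hT hC hZ hZW M)) (fun Y => StructuredArrow.homMk
      (ObjectProperty.homMk (quotRepDesc (radical_stable C M.obj) Y.hom.hom fun x hx =>
        eq_zero_of_mem_radical hG hT Y.right.property.1 (Y.right.property.2.trans hZC)
          (map_mem_radical _ hx))) ?_) fun Y m => ?_).hasInitial
  · exact ObjectProperty.hom_ext _ (quotRepπ_comp_desc _ _ _)
  · refine StructuredArrow.ext _ _ (ObjectProperty.hom_ext _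
      (epi_of_surjective (quotRepπ_surjective (radical_stable C M.obj)) ?_))
    have h1 := StructuredArrow.w m
    exact congrArg (fun k => k.hom) h1

end Quotient

section Unit

variable {W Z C : Set (SmoothDual G)} {hZW : Z ⊆ W} {F : SmoothRepOn W ⥤ SmoothRepOn Z}
  (adj : F ⊣ inclusion hZW)

/-- The unit of an adjunction, as a morphism of representations. -/
def unitHom (M : SmoothRepOn W) : M.obj ⟶ (F.obj M).obj :=
  (adj.unit.app M).hom

theorem exists_unit_factor (M : SmoothRepOn W) (N : SmoothRepOn Z) (f : M.obj ⟶ N.obj) :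
    ∃ f' : F.obj M ⟶ N, ∀ x, f'.hom.hom ((unitHom adj M).hom x) = f.hom x := by
  let f₁ : M ⟶ (inclusion hZW).obj N := ObjectProperty.homMk f
  refine ⟨(adj.homEquiv M N).symm f₁, fun x => ?_⟩
  have h1 : adj.unit.app M ≫ (inclusion hZW).map ((adj.homEquiv M N).symm f₁) = f₁ := by
    exact (adj.homEquiv_unit ..).symm.trans (Equiv.apply_symm_apply _ _)
  exact congrArg (fun k : M ⟶ (inclusion hZW).obj N => k.hom.hom x) h1

theorem unit_ext {M : SmoothRepOn W} {N : SmoothRepOn Z} {f f' : F.obj M ⟶ N}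
    (h : ∀ x, f.hom.hom ((unitHom adj M).hom x) = f'.hom.hom ((unitHom adj M).hom x)) : f = f' := by
  apply (adj.homEquiv M N).injective
  rw [adj.homEquiv_unit, adj.homEquiv_unit]
  exact ObjectProperty.hom_ext _ (hom_ext_apply h)

theorem unit_naturality {M N : SmoothRepOn W} (f : M ⟶ N) (x : M.obj.V) :
    (F.map f).hom.hom ((unitHom adj M).hom x) = (unitHom adj N).hom (f.hom.hom x) :=
  congrArg (fun k : M ⟶ (inclusion hZW).obj (F.obj N) => k.hom.hom x) (adj.unit.naturality f).symm

/-- The unit is surjective, since the projection to its cokernel and the zero map agree on `M`. -/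
theorem unit_surjective (hG : IsEllCGroup G) (M : SmoothRepOn W) :
    Function.Surjective (unitHom adj M).hom := by
  have := hG.isTopologicalGroup
  have hA := range_stable (unitHom adj M)
  let T : SmoothRepOn Z := ⟨quotRep (F.obj M).obj _ hA,
    (F.obj M).property.1.of_surjective (quotRepπ _ _ hA) (quotRepπ_surjective hA),
    (supp_subset_of_surjective _ (quotRepπ_surjective hA)).trans (F.obj M).property.2⟩
  let q : F.obj M ⟶ T := ObjectProperty.homMk (quotRepπ _ _ hA)
  let z : F.obj M ⟶ T := ObjectProperty.homMk 0
  have hqz : q = z := unit_ext adj fun x => (quotRepπ_eq_zero hA).2 ⟨x, rfl⟩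
  intro y
  have h1 : q.hom.hom y = 0 := by
    rw [hqz]
    rfl
  exact (quotRepπ_eq_zero hA).1 h1

theorem unit_eq_zero_iff (hG : IsEllCGroup G) (hT : IsTame G) (hC : IsClosed C)
    (hZ : W ∩ C ⊆ Z) (hZC : Z ⊆ C) (M : SmoothRepOn W) (x : M.obj.V) :
    (unitHom adj M).hom x = 0 ↔ x ∈ radical C M.obj := by
  constructor
  · intro h
    obtain ⟨f, hf⟩ := exists_unit_factor adj M (radicalQuotient hG hT hC hZ M)
      (quotRepπ M.obj _ (radical_stable C M.obj))
    have h1 := hf x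
    rw [h, map_zero] at h1
    exact (quotRepπ_eq_zero (radical_stable C M.obj)).1 h1.symm
  · intro h
    exact eq_zero_of_mem_radical hG hT (F.obj M).property.1 ((F.obj M).property.2.trans hZC)
      (map_mem_radical _ h)

end Unit

/-- If `g x` lies in the radical of `P`, then `x` is congruent to an element of the radical of `N`
modulo any stable subspace `A` containing the kernel of `g`: irreducible representations in `C`
separate the vectors of `N / (A + rad N)`, and they extend along `N / ker g → P`. -/
theorem mem_sup_radical (hG : IsEllCGroup G) (hT : IsTame G) {C : Set (SmoothDual G)}
    (hC : IsClosed C) {N P : Rep.{u} ℂ G} (hN : IsSmooth N) (hP : IsSmooth P) (g : N ⟶ P)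
    {A : Submodule ℂ N.V} (hA : ∀ h, ∀ x ∈ A, N.ρ h x ∈ A)
    (hAg : LinearMap.ker g.hom.toLinearMap ≤ A) {x : N.V} (hx : g.hom x ∈ radical C P) :
    x ∈ A ⊔ radical C N := by
  have := hG.isTopologicalGroup
  have hB : ∀ h, ∀ x ∈ A ⊔ radical C N, N.ρ h x ∈ A ⊔ radical C N := by
    intro h y hy
    obtain ⟨a, ha, r, hr, rfl⟩ := Submodule.mem_sup.1 hy
    rw [map_add]
    exact Submodule.add_mem_sup (hA h a ha) (radical_stable C N h r hr)
  by_contra hcon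
  set q := quotRepπ N _ hB with hq
  obtain ⟨π, f, hf⟩ := exists_irreducible_quotient hG hT
    (hN.of_surjective q (quotRepπ_surjective hB))
    (m := q.hom x) (fun h => hcon ((quotRepπ_eq_zero hB).1 h))
  have hπ : π.cls ∈ C := by
    refine supp_quot_radical_subset hG hT hC hN (supp_subset_of_surjective
      (quotRepDesc (radical_stable C N) q fun y hy =>
        (quotRepπ_eq_zero hB).2 (Submodule.mem_sup_right hy)) (fun y => ?_)
      ⟨π, rfl, f, ne_zero_of_apply hf⟩)
    obtain ⟨z, rfl⟩ := quotRepπ_surjective hB y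
    exact ⟨_, quotRepDesc_apply _ _ _ z⟩
  have hk := ker_stable g
  let j : quotRep N _ hk ⟶ P := quotRepDesc hk g fun _ h => h
  have hj : Function.Injective j.hom := by
    refine (injective_iff_map_eq_zero j.hom).2 fun y hy => ?_
    obtain ⟨z, rfl⟩ := quotRepπ_surjective hk y
    exact (quotRepπ_eq_zero hk).2 hy
  obtain ⟨k, hkf⟩ := exists_extension hG hP (hT π) j hj (quotRepDesc hk (q ≫ f) fun y hy => by
    have h1 : q.hom y = 0 := (quotRepπ_eq_zero hB).2 (Submodule.mem_sup_left (hAg hy))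
    change f.hom (q.hom y) = 0
    rw [h1, map_zero])
  have h1 : k.hom (g.hom x) = f.hom (q.hom x) :=
    congrArg (fun l : quotRep N _ hk ⟶ π.obj => l.hom ((quotRepπ N _ hk).hom x)) hkf
  exact hf (h1.symm.trans (mem_radical.1 hx π hπ k))

theorem isExactFunctor_of_adjunction (hG : IsEllCGroup G) (hT : IsTame G)
    {W Z C : Set (SmoothDual G)} (hC : IsClosed C) (hZ : W ∩ C ⊆ Z) (hZW : Z ⊆ W) (hZC : Z ⊆ C)
    {F : SmoothRepOn W ⥤ SmoothRepOn Z} (adj : F ⊣ inclusion hZW) : IsExactFunctor F := by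
  intro M N P f g hfg y
  have hfg' : ∀ y, g.hom.hom y = 0 ↔ y ∈ Set.range f.hom.hom := hfg
  obtain ⟨n, rfl⟩ := unit_surjective adj hG N y
  constructor
  · intro hy
    rw [unit_naturality, unit_eq_zero_iff adj hG hT hC hZ hZC] at hy
    obtain ⟨_, ⟨m, rfl⟩, r, hr, rfl⟩ := Submodule.mem_sup.1 (mem_sup_radical hG hT hC
      N.property.1 P.property.1 g.hom (range_stable f.hom) (fun y hy => (hfg' y).1 hy) hy)
    refine ⟨(unitHom adj M).hom m, ?_⟩
    rw [unit_naturality, map_add, (unit_eq_zero_iff adj hG hT hC hZ hZC N r).2 hr, add_zero]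
    rfl
  · rintro ⟨y, hy⟩
    obtain ⟨m, rfl⟩ := unit_surjective adj hG M y
    rw [← hy, unit_naturality, unit_naturality, (hfg' _).2 ⟨m, rfl⟩, map_zero]

theorem exists_fixed_ne_zero (hG : IsEllCGroup G) (π : Irr G) :
    ∃ (K : Subgroup G) (v : π.obj.V), IsCompactOpen K ∧ v ∈ fixedPts π.obj.ρ K ∧ v ≠ 0 := by
  have := π.property.2
  obtain ⟨v, hv⟩ : ∃ v : π.obj.V, v ≠ 0 := by
    by_contra! hcon
    refine bot_ne_top (α := Subrepresentation π.obj.ρ) (Subrepresentation.toSubmodule_injective ?_)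
    ext x
    rw [hcon x]
    exact ⟨fun _ => zero_mem _, fun _ => zero_mem _⟩
  obtain ⟨K, hK, hKv⟩ := IsSmoothRep.exists_fixing (ρ := π.obj.ρ) hG π.property.1 {v}
  exact ⟨K, v, hK, hKv v (by simp), hv⟩

/-- A left adjoint forces `Z` to be closed in `W = U ∩ C`. The test object is the largest quotient
with support in `C` of the radical of `ℂ[G ⧸ K]` with respect to the complement of `U`. An element
of it killed by the unit is killed by all maps to members of `Z`, hence, by openness of
non-vanishing, by the map to a member `π` of the closure of `Z` in `W`; so `π` is a quotient of the
image of the unit. -/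
theorem cls_mem_of_mem_closure (hG : IsEllCGroup G) (hT : IsTame G)
    {W Z U C : Set (SmoothDual G)} (hU : IsOpen U) (hC : IsClosed C) (hW : W = U ∩ C) {hZW : Z ⊆ W}
    {F : SmoothRepOn W ⥤ SmoothRepOn Z} (adj : F ⊣ inclusion hZW) {π : Irr G} (hπW : π.cls ∈ W)
    (hπ : π.cls ∈ closure Z) : π.cls ∈ Z := by
  have := hG.isTopologicalGroup
  have hπU : π.cls ∈ U := (hW ▸ hπW : π.cls ∈ U ∩ C).1
  have hπC : π.cls ∈ C := (hW ▸ hπW : π.cls ∈ U ∩ C).2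
  obtain ⟨K, v, hK, hv, hv0⟩ := exists_fixed_ne_zero hG π
  have hM₀ : IsSmooth (cosetRep K) := isSmooth_cosetRep hK.2
  have hD := radical_stable Uᶜ (cosetRep K)
  let M₁ := subRep (cosetRep K) _ hD
  let i : M₁ ⟶ cosetRep K := subRepι (cosetRep K) _ hD
  have hi : Function.Injective i.hom := subRepι_injective hD
  have hM₁ : IsSmooth M₁ := hM₀.of_injective i hi
  have hsupp₁ : supp M₁ ⊆ U := by
    rintro _ ⟨σ, rfl, f, hf⟩
    by_contra hσ
    obtain ⟨g, rfl⟩ := exists_extension hG hM₀ (hT σ) i hi f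
    obtain ⟨x, hx⟩ := exists_apply_ne_zero hf
    exact hx (mem_radical.1 x.2 σ hσ g)
  have hR := radical_stable C M₁
  let M₂ : SmoothRepOn W := ⟨quotRep M₁ _ hR,
    hM₁.of_surjective (quotRepπ M₁ _ hR) (quotRepπ_surjective hR), fun x hx =>
      hW ▸ ⟨hsupp₁ (supp_subset_of_surjective _ (quotRepπ_surjective hR) hx),
        supp_quot_radical_subset hG hT hC hM₁ hx⟩⟩
  have hdesc : ∀ (σ : Irr G) (w : σ.obj.V) (hw : w ∈ fixedPts σ.obj.ρ K), σ.cls ∈ C →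
      ∃ f : M₂.obj ⟶ σ.obj, ∀ x : M₁.V,
        f.hom ((quotRepπ M₁ _ hR).hom x) = (cosetLift w hw).hom (i.hom x) := fun σ w hw hσ =>
    ⟨quotRepDesc hR (i ≫ cosetLift w hw) fun x hx => mem_radical.1 hx σ hσ _, fun x => rfl⟩
  obtain ⟨φ, hφ⟩ := hdesc π v hv hπC
  obtain ⟨x₀, hx₀⟩ : ∃ x : M₁.V, (cosetLift v hv).hom (i.hom x) ≠ 0 := by
    by_contra! hcon
    refine cls_mem_of_radical_le_ker hG hT hU.isClosed_compl hM₀ (f := cosetLift v hv) ?_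
      (fun x hx => hcon ⟨x, hx⟩) hπU
    exact ne_zero_of_apply (v := Finsupp.single ((1 : G) : G ⧸ K) 1)
      (by rwa [cosetLift_single_one])
  set η := unitHom adj M₂ with hη
  have hker : ∀ y ∈ LinearMap.ker η.hom.toLinearMap, φ.hom y = 0 := by
    intro y hy
    obtain ⟨x, rfl⟩ := quotRepπ_surjective hR y
    by_contra hne
    rw [hφ] at hne
    obtain ⟨_, ⟨σ, rfl, w, hw, hσx⟩, hσZ⟩ := mem_closure_iff.1 hπ _
      (isOpen_cosetLift_ne_zero hG hK (i.hom x)) ⟨π, rfl, v, hv, hne⟩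
    obtain ⟨ψ, hψ⟩ := hdesc σ w hw (hW ▸ hZW hσZ : σ.cls ∈ U ∩ C).2
    obtain ⟨ψ', hψ'⟩ := exists_unit_factor adj M₂ (σ.toSmoothRepOn hσZ) ψ
    have h1 : η.hom ((quotRepπ M₁ _ hR).hom x) = 0 := hy
    have h2 := hψ' ((quotRepπ M₁ _ hR).hom x)
    rw [← hη, h1, map_zero] at h2
    exact hσx ((hψ x).symm.trans h2.symm)
  have hk := ker_stable η
  let j : quotRep M₂.obj _ hk ⟶ (F.obj M₂).obj := quotRepDesc hk η fun _ h => h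
  have hj : Function.Injective j.hom := by
    refine (injective_iff_map_eq_zero j.hom).2 fun y hy => ?_
    obtain ⟨z, rfl⟩ := quotRepπ_surjective hk y
    exact (quotRepπ_eq_zero hk).2 hy
  refine (F.obj M₂).property.2 (supp_subset_of_injective hG hT (F.obj M₂).property.1 j hj
    ⟨π, rfl, quotRepDesc hk φ hker, ne_zero_of_apply
      (v := (quotRepπ M₂.obj _ hk).hom ((quotRepπ M₁ _ hR).hom x₀)) ?_⟩)
  rw [quotRepDesc_apply, hφ]
  exact hx₀

end Adjoint
end EllGroup

theorem mainTheorem2 {G : Type u} [Group G] [TopologicalSpace G]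
    (hG : EllGroup.IsEllCGroup G) (hT : EllGroup.IsTame G)
    (W Z : Set (EllGroup.SmoothDual G)) (hW : IsLocallyClosed W) (hZW : Z ⊆ W) :
    ((EllGroup.inclusion hZW).IsRightAdjoint ↔ IsClosed ((↑) ⁻¹' Z : Set W)) ∧
    ∀ (F : EllGroup.SmoothRepOn W ⥤ EllGroup.SmoothRepOn Z),
      (F ⊣ EllGroup.inclusion hZW) → EllGroup.IsExactFunctor F := by
  have hclosed : (EllGroup.inclusion hZW).IsRightAdjoint → IsClosed ((↑) ⁻¹' Z : Set W) := by
    intro h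
    obtain ⟨U, C, hU, hC, hUC⟩ := hW
    refine isClosed_of_closure_subset fun x hx => ?_
    obtain ⟨⟨π⟩, hπ⟩ := x
    rw [closure_subtype] at hx
    exact EllGroup.cls_mem_of_mem_closure hG hT hU hC hUC
      (Adjunction.ofIsRightAdjoint (EllGroup.inclusion hZW)) hπ
      (closure_mono (Set.image_preimage_subset _ _) hx)
  have hexists : IsClosed ((↑) ⁻¹' Z : Set W) → ∃ C, IsClosed C ∧ W ∩ C ⊆ Z ∧ Z ⊆ C := by
    intro h
    obtain ⟨C, hC, hCZ⟩ := isClosed_induced_iff.1 h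
    exact ⟨C, hC, fun x hx => (hCZ ▸ hx.2 : (⟨x, hx.1⟩ : W) ∈ ((↑) ⁻¹' Z : Set W)),
      fun x hx => (hCZ.symm ▸ hx : (⟨x, hZW hx⟩ : W) ∈ ((↑) ⁻¹' C : Set W))⟩
  refine ⟨⟨hclosed, fun h => ?_⟩, fun F adj => ?_⟩
  · obtain ⟨C, hC, hZ, hZC⟩ := hexists h
    exact EllGroup.isRightAdjoint_inclusion hG hT hC hZ hZW hZC
  · obtain ⟨C, hC, hZ, hZC⟩ := hexists (hclosed adj.isRightAdjoint)
    exact EllGroup.isExactFunctor_of_adjunction hG hT hC hZ hZW hZC adj
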